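/- A CDG-ring $B^\bullet=(B,d,h)$ is a graded ring $B=\bigoplus_{i\in\mathbb Z}B^i$ (associative, unital) with an additive map $d\colon B\to B$ of degree $1$ satisfying $d(bc)=d(b)c+(-1)^{|b|}b\,d(c)$ for homogeneous $b,c$, and an element $h\in B^2$ with $d^2(b)=hb-bh$ for all $b\in B$ and $d(h)=0$. A left CDG-module $(M,d_M)$ over $B^\bullet$ is a graded left $B$-module $M$ with an additive map $d_M\colon M\to M$ of degree $1$ satisfying $d_M(bx)=d(b)x+(-1)^{|b|}b\,d_M(x)$ for homogeneous $b,x$ and $d_M^2(x)=hx$. Morphisms in the homotopy category $\mathrm{Hot}(B^\bullet)$ of left CDG-modules are the homogeneous $B$-linear maps of degree $0$ commuting with the differentials, up to cochain homotopy; it is a triangulated category with the usual shifts and cones. For a short exact sequence $0\to K\xrightarrow{f} L\to M\to0$ of left CDG-modules and such morphisms, its totalization is $\mathrm{cone}(\mathrm{cone}(f)\to M)$. A left CDG-module is coacyclic (respectively, contraacyclic) if it belongs to the minimal (strictly full) triangulated subcategory of $\mathrm{Hot}(B^\bullet)$ that contains the totalizations of all short exact sequences of left CDG-modules and is closed under infinite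 direct sums (respectively, infinite products). For a graded left $B$-module $L$, the shift is $L[a]^n=L^{n+a}$, with a homogeneous $b\in B$ acting by $(-1)^{a|b|}b$. Let $B^\bullet=(B,d,h)$ be a CDG-ring. (a) Let $N^\bullet=(N,d_N)$ be a left CDG-module over $B^\bullet$, and let $0=F_0N\subset F_1N\subset F_2N\subset\cdots$ be an exhaustive increasing filtration of $N$ by graded $B$-submodules (exhaustive: $N=\bigcup_iF_iN$). Assume that $d_N(F_iN)\subset F_{i+1}N$ for all $i\ge1$ and that the complex of graded left $B$-modules $$0\to F_1N[1]\to (F_2N/F_1N)[2]\to (F_3N/F_2N)[3]\to\cdots$$ with the differential induced by $d_N$ is acyclic. Then the CDG-module $N^\bullet$ is coacyclic. (b) Let $Q^\bullet=(Q,d_Q)$ be a left CDG-module over $B^\bullet$, and let $Q=F^0Q\supset F^1Q\supset F^2Q\supset\cdots$ be a decreasing filtration of $Q$ by graded $B$-submodules that is (separated and) complete, i.e. $Q=\varprojlim_i Q/F^iQ$ in the category of graded modules. Assume that $d_Q(F^iQ)\subset F^{i-1}Q$ for all $i\ge2$ and that the complex of graded left $B$-modules $$\cdots\to (F^2Q/F^3Q)[-2]\to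 (F^1Q/F^2Q)[-1]\to Q/F^1Q\to0$$ with the differential induced by $d_Q$ is acyclic. Then the CDG-module $Q^\bullet$ is contraacyclic. -/

import Mathlib

universe u v

namespace CDG

/-- The structure of a CDG-ring `(B, d, h)` on a graded ring `B = ⨁ 𝓑 i`: an odd derivation `d`
of degree `1` and a curvature element `h ∈ B²` with `d² = [h, -]` and `d h = 0`. -/
structure CDGRing {B : Type u} [Ring B] (𝓑 : ℤ → AddSubgroup B) [GradedRing 𝓑] where
  d : B →+ B
  d_mem : ∀ {i : ℤ} {b : B}, b ∈ 𝓑 i → d b ∈ 𝓑 (i + 1)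
  leibniz : ∀ {i j : ℤ} {b c : B}, b ∈ 𝓑 i → c ∈ 𝓑 j →
    d (b * c) = d b * c + i.negOnePow • (b * d c)
  h : B
  h_mem : h ∈ 𝓑 2
  d_d : ∀ b : B, d (d b) = h * b - b * h
  d_h : d h = 0

section Graded

variable {B : Type u} [Ring B] (𝓑 : ℤ → AddSubgroup B) [GradedRing 𝓑]

/-- The unit as an element of the component of degree `0`. -/
def one : 𝓑 0 := ⟨1, SetLike.GradedOne.one_mem⟩

variable {𝓑}

/-- The product of homogeneous elements, `B^i × B^j → B^k` for `i + j = k`. -/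
def mul {i j k : ℤ} (h : i + j = k) (b : 𝓑 i) (c : 𝓑 j) : 𝓑 k :=
  ⟨b * c, h ▸ SetLike.GradedMul.mul_mem b.2 c.2⟩

variable (𝓑)

/-- A graded left `B`-module `M = ⨁ Mⁿ`, given by its components `Mⁿ` (`n ∈ ℤ`) and the biadditive
action maps `B^i × M^j → M^k` for `i + j = k`. -/
structure GrModule where
  carrier : ℤ → Type v
  [addCommGroup : ∀ n, AddCommGroup (carrier n)]
  smul : ∀ {i j k : ℤ}, i + j = k → 𝓑 i →+ carrier j →+ carrier k
  one_smul : ∀ {j : ℤ} (x : carrier j), smul (zero_add j) (one 𝓑) x = x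
  mul_smul : ∀ {i j k ij jk ijk : ℤ} (h₁ : i + j = ij) (h₂ : j + k = jk) (h₃ : ij + k = ijk)
    (h₄ : i + jk = ijk) (b : 𝓑 i) (c : 𝓑 j) (x : carrier k),
    smul h₃ (mul h₁ b c) x = smul h₄ b (smul h₂ c x)

attribute [instance] GrModule.addCommGroup

variable {𝓑}

/-- A morphism of graded left `B`-modules (homogeneous of degree `0`). -/
structure GrHom (M N : GrModule.{u, v} 𝓑) where
  app : ∀ n : ℤ, M.carrier n →+ N.carrier n
  app_smul : ∀ {i j k : ℤ} (h : i + j = k) (b : 𝓑 i) (x : M.carrier j),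
    app k (M.smul h b x) = N.smul h b (app j x)

/-- A graded `B`-submodule. -/
structure GrSubmodule (M : GrModule.{u, v} 𝓑) where
  comp : ∀ n : ℤ, AddSubgroup (M.carrier n)
  smul_mem : ∀ {i j k : ℤ} (h : i + j = k) (b : 𝓑 i) {x : M.carrier j},
    x ∈ comp j → M.smul h b x ∈ comp k

theorem map_sign {G H : Type*} [AddCommGroup G] [AddCommGroup H] (f : G →+ H) (e : ℤˣ) (x : G) :
    f (e • x) = e • f x := by
  simp [Units.smul_def, map_zsmul]

theorem directSum_sign_apply {ι : Type*} {G : ι → Type*} [∀ a, AddCommGroup (G a)] (e : ℤˣ)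
    (x : DirectSum ι G) (a : ι) : (e • x) a = e • x a :=
  map_sign ((Pi.evalAddMonoidHom G a).comp (DirectSum.coeFnAddMonoidHom G)) e x

/-- The grading shift `M[a]`: `M[a]ⁿ = M^{n+a}`, where a homogeneous `b` acts on `M[a]` as
`(-1)^{a|b|} b`. -/
def GrModule.shift (M : GrModule.{u, v} 𝓑) (a : ℤ) : GrModule.{u, v} 𝓑 where
  carrier n := M.carrier (n + a)
  smul {i j k} h := (a * i).negOnePow • M.smul (show i + (j + a) = k + a by omega)
  one_smul {j} x := by
    have := M.one_smul x
    simpa using this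
  mul_smul {i j k ij jk ijk} h₁ h₂ h₃ h₄ b c x := by
    subst h₁
    simp only [AddMonoidHom.smul_apply, mul_add, Int.negOnePow_add, map_sign]
    rw [M.mul_smul rfl (show j + (k + a) = jk + a by omega) _ (by omega) b c x, smul_smul,
      mul_comm (a * i).negOnePow]

/-- The subquotient `K / (K ∩ L)` of a graded module; it is used for `L ⊆ K`, where it is `K/L`. -/
def GrSubmodule.subquotient {M : GrModule.{u, v} 𝓑} (K L : GrSubmodule M) :
    GrModule.{u, v} 𝓑 where
  carrier n := K.comp n ⧸ (L.comp n).addSubgroupOf (K.comp n)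
  smul {i j k} h := AddMonoidHom.mk'
    (fun b => QuotientAddGroup.map _ _
      (((M.smul h b).comp (K.comp j).subtype).codRestrict (K.comp k)
        (fun x => K.smul_mem h b x.2))
      (fun x hx => by
        rw [AddSubgroup.mem_comap, AddSubgroup.mem_addSubgroupOf]
        exact L.smul_mem h b (AddSubgroup.mem_addSubgroupOf.1 hx)))
    (fun b c => by
      ext x
      obtain ⟨x⟩ := x
      refine congrArg (QuotientAddGroup.mk) (Subtype.ext ?_)
      exact DFunLike.congr_fun (map_add (M.smul h) b c) (x : M.carrier j))
  one_smul {j} x := by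
    obtain ⟨x⟩ := x
    exact congrArg (QuotientAddGroup.mk) (Subtype.ext (M.one_smul (x : M.carrier j)))
  mul_smul {i j k ij jk ijk} h₁ h₂ h₃ h₄ b c x := by
    obtain ⟨x⟩ := x
    exact congrArg (QuotientAddGroup.mk)
      (Subtype.ext (M.mul_smul h₁ h₂ h₃ h₄ b c (x : M.carrier k)))

/-- `0 → X₀ → X₁ → X₂ → ⋯` is an acyclic complex of graded modules. -/
def IsAcyclicRight (X : ℕ → GrModule.{u, v} 𝓑) (δ : ∀ i, GrHom (X i) (X (i + 1))) : Prop :=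
  ∀ n : ℤ, Function.Injective ((δ 0).app n) ∧
    ∀ i, Function.Exact ((δ i).app n) ((δ (i + 1)).app n)

/-- `⋯ → X₂ → X₁ → X₀ → 0` is an acyclic complex of graded modules. -/
def IsAcyclicLeft (X : ℕ → GrModule.{u, v} 𝓑) (δ : ∀ i, GrHom (X (i + 1)) (X i)) : Prop :=
  ∀ n : ℤ, Function.Surjective ((δ 0).app n) ∧
    ∀ i, Function.Exact ((δ (i + 1)).app n) ((δ i).app n)

/-- An increasing filtration of `M` is exhaustive: `M = ⋃ F_i M`. -/
def IsExhaustive {M : GrModule.{u, v} 𝓑} (F : ℕ → GrSubmodule M) : Prop :=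
  ∀ (n : ℤ) (x : M.carrier n), ∃ i, x ∈ (F i).comp n

/-- A decreasing filtration of `M` is (separated and) complete: the map from `M` to the inverse
limit of the `M/F^i M` in the category of graded modules is bijective, i.e. in every degree `n`,
each compatible family of elements of the groups `Mⁿ/F^i Mⁿ` comes from a unique element
of `Mⁿ`. -/
def IsCompleteFiltration {M : GrModule.{u, v} 𝓑} (F : ℕ → GrSubmodule M)
    (hF : ∀ i n, (F (i + 1)).comp n ≤ (F i).comp n) : Prop :=
  ∀ (n : ℤ) (s : ∀ i, M.carrier n ⧸ (F i).comp n),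
    (∀ i, QuotientAddGroup.map ((F (i + 1)).comp n) ((F i).comp n) (AddMonoidHom.id _) (hF i n)
      (s (i + 1)) = s i) →
    ∃! x : M.carrier n, ∀ i, (QuotientAddGroup.mk x : M.carrier n ⧸ (F i).comp n) = s i

end Graded

section Modules

variable {B : Type u} [Ring B] {𝓑 : ℤ → AddSubgroup B} [GradedRing 𝓑]

/-- The differential `B^i → B^{i+1}`. -/
def CDGRing.dHom (C : CDGRing 𝓑) {i : ℤ} (b : 𝓑 i) : 𝓑 (i + 1) := ⟨C.d b, C.d_mem b.2⟩

/-- The curvature element as an element of `B²`. -/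
def CDGRing.curv (C : CDGRing 𝓑) : 𝓑 2 := ⟨C.h, C.h_mem⟩

/-- A left CDG-module `(M, d_M)` over the CDG-ring `C`. -/
structure CDGModule (C : CDGRing 𝓑) extends GrModule.{u, v} 𝓑 where
  d : ∀ {i j : ℤ}, i + 1 = j → carrier i →+ carrier j
  leibniz : ∀ {i j k j' k' : ℤ} (h : i + j = k) (hj : j + 1 = j') (hk : k + 1 = k')
    (b : 𝓑 i) (x : carrier j),
    d hk (smul h b x) = smul (show i + 1 + j = k' by omega) (C.dHom b) x +
      i.negOnePow • smul (show i + j' = k' by omega) b (d hj x)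
  d_d : ∀ {i j k : ℤ} (h₁ : i + 1 = j) (h₂ : j + 1 = k) (x : carrier i),
    d h₂ (d h₁ x) = smul (show 2 + i = k by omega) C.curv x

namespace CDGModule

variable {C : CDGRing 𝓑}

/-- A closed morphism of degree `0` of CDG-modules. -/
structure Hom (M N : CDGModule.{u, v} C) extends GrHom M.toGrModule N.toGrModule where
  comm : ∀ {i j : ℤ} (h : i + 1 = j) (x : M.carrier i), app j (M.d h x) = N.d h (app i x)

/-- The identity morphism. -/
def Hom.id (M : CDGModule.{u, v} C) : Hom M M where
  app _ := AddMonoidHom.id _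
  app_smul _ _ _ := rfl
  comm _ _ := rfl

/-- Composition: `f.comp g` is `g` followed by `f`. -/
def Hom.comp {L M N : CDGModule.{u, v} C} (f : Hom M N) (g : Hom L M) : Hom L N where
  app n := (f.app n).comp (g.app n)
  app_smul h b x := by simp [g.app_smul, f.app_smul]
  comm h x := by simp [g.comm, f.comm]

/-- A cochain homotopy between closed morphisms `f` and `g` of degree `0`: a homogeneous
`B`-linear map `s` of degree `-1` with `f - g = d s + s d`. Linearity of a map of degree `-1`
involves the sign `s (b x) = (-1)^{|b|} b s(x)`. -/
structure Homotopy {M N : CDGModule.{u, v} C} (f g : Hom M N) where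
  s : ∀ {i j : ℤ}, j + 1 = i → M.carrier i →+ N.carrier j
  s_smul : ∀ {i j k j' k' : ℤ} (h : i + j = k) (hj : j' + 1 = j) (hk : k' + 1 = k)
    (b : 𝓑 i) (x : M.carrier j),
    s hk (M.smul h b x) = i.negOnePow • N.smul (show i + j' = k' by omega) b (s hj x)
  sub_eq : ∀ {i j k : ℤ} (h₁ : i + 1 = j) (h₂ : j + 1 = k) (x : M.carrier j),
    f.app j x - g.app j x = N.d h₁ (s h₁ x) + s h₂ (M.d h₂ x)

/-- `M` and `N` are homotopy equivalent, i.e. isomorphic in the homotopy category of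
CDG-modules, whose morphisms are the closed morphisms of degree `0` up to cochain homotopy. -/
def HomotopyEquivalent (M N : CDGModule.{u, v} C) : Prop :=
  ∃ (f : Hom M N) (g : Hom N M),
    Nonempty (Homotopy (g.comp f) (Hom.id M)) ∧ Nonempty (Homotopy (f.comp g) (Hom.id N))

/-- The zero CDG-module. -/
def zero (C : CDGRing 𝓑) : CDGModule.{u, v} C where
  carrier _ := PUnit
  smul _ := 0
  one_smul _ := rfl
  mul_smul _ _ _ _ _ _ _ := rfl
  d _ := 0
  leibniz _ _ _ _ _ := rfl
  d_d _ _ _ := rfl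

/-- The shift `M[a]`, with differential `(-1)^a d_M`. -/
def shift (M : CDGModule.{u, v} C) (a : ℤ) : CDGModule.{u, v} C where
  toGrModule := M.toGrModule.shift a
  d {i j} h := a.negOnePow • M.d (show i + a + 1 = j + a by omega)
  leibniz {i j k j' k'} h hj hk b x := by
    have key : ∀ y : M.carrier (j + a),
        a.negOnePow • M.d (show k + a + 1 = k' + a by omega)
          ((a * i).negOnePow • M.smul (show i + (j + a) = k + a by omega) b y) =
        (a * (i + 1)).negOnePow •
          M.smul (show i + 1 + (j + a) = k' + a by omega) (C.dHom b) y +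
        i.negOnePow • (a * i).negOnePow • M.smul (show i + (j' + a) = k' + a by omega) b
          (a.negOnePow • M.d (show j + a + 1 = j' + a by omega) y) := by
      intro y
      simp only [map_sign]
      rw [M.leibniz (show i + (j + a) = k + a by omega) (show j + a + 1 = j' + a by omega)
        (show k + a + 1 = k' + a by omega) b y]
      simp only [smul_add, smul_smul, mul_add, mul_one, Int.negOnePow_add]
      congr 2 <;> ac_rfl
    exact key x
  d_d {i j k} h₁ h₂ x := by
    have key : ∀ y : M.carrier (i + a),
        a.negOnePow • M.d (show j + a + 1 = k + a by omega)
          (a.negOnePow • M.d (show i + a + 1 = j + a by omega) y) =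
        (a * 2).negOnePow • M.smul (show 2 + (i + a) = k + a by omega) C.curv y := by
      intro y
      rw [map_sign, M.d_d _ _ y, smul_smul, ← Int.negOnePow_add, mul_two]
    exact key x

/-- The component `M^i → N^j` of a morphism for `i = j`. -/
def Hom.appEq {M N : CDGModule.{u, v} C} (f : Hom M N) {i j : ℤ} (h : i = j) :
    M.carrier i →+ N.carrier j :=
  h ▸ f.app i

/-- The cone of a closed morphism `f : K → L` of degree `0`: the graded module `K[1] ⊕ L` with
differential `d (x, y) = (-d x, f x + d y)`. -/
def cone {K L : CDGModule.{u, v} C} (f : Hom K L) : CDGModule.{u, v} C where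
  carrier n := (K.shift 1).carrier n × L.carrier n
  smul {i j k} h := AddMonoidHom.mk'
    (fun b => AddMonoidHom.prodMap ((K.shift 1).smul h b) (L.smul h b))
    (fun b c => by ext x <;> simp)
  one_smul x := Prod.ext ((K.shift 1).one_smul x.1) (L.one_smul x.2)
  mul_smul h₁ h₂ h₃ h₄ b c x :=
    Prod.ext ((K.shift 1).mul_smul h₁ h₂ h₃ h₄ b c x.1) (L.mul_smul h₁ h₂ h₃ h₄ b c x.2)
  d {i j} h := AddMonoidHom.prod (((K.shift 1).d h).comp (AddMonoidHom.fst _ _))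
    (AddMonoidHom.coprod (f.appEq h) (L.d h))
  leibniz {i j k j' k'} h hj hk b x := by
    subst hj hk
    refine Prod.ext ((K.shift 1).leibniz h rfl rfl b x.1) ?_
    have key : ∀ (y : K.carrier (j + 1)) (z : L.carrier j),
        f.app (k + 1) ((1 * i).negOnePow • K.smul (show i + (j + 1) = k + 1 by omega) b y) +
          L.d rfl (L.smul h b z) =
        L.smul (show i + 1 + j = k + 1 by omega) (C.dHom b) z +
          i.negOnePow • L.smul (show i + (j + 1) = k + 1 by omega) b
            (f.app (j + 1) y + L.d rfl z) := by
      intro y z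
      rw [map_sign, f.app_smul, L.leibniz h rfl rfl b z, one_mul, map_add, smul_add]
      abel
    exact key x.1 x.2
  d_d {i j k} h₁ h₂ x := by
    subst h₁ h₂
    refine Prod.ext ((K.shift 1).d_d rfl rfl x.1) ?_
    have key : ∀ (y : K.carrier (i + 1)) (z : L.carrier i),
        f.app (i + 1 + 1) ((1 : ℤ).negOnePow • K.d rfl y) +
          L.d rfl (f.app (i + 1) y + L.d rfl z) =
        L.smul (show 2 + i = i + 1 + 1 by omega) C.curv z := by
      intro y z
      rw [map_sign, f.comm, map_add, L.d_d, Int.negOnePow_one, Units.neg_smul, one_smul]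
      abel
    exact key x.1 x.2

/-- `0 → K → L → M → 0` is a short exact sequence of CDG-modules. -/
structure ShortExact {K L M : CDGModule.{u, v} C} (f : Hom K L) (g : Hom L M) : Prop where
  injective : ∀ n, Function.Injective (f.app n)
  exact : ∀ n, Function.Exact (f.app n) (g.app n)
  surjective : ∀ n, Function.Surjective (g.app n)

/-- The morphism `cone f → M`, `(x, y) ↦ g y`, induced by a morphism `g` with `g ∘ f = 0`. -/
def coneDesc {K L M : CDGModule.{u, v} C} (f : Hom K L) (g : Hom L M)
    (w : ∀ n x, g.app n (f.app n x) = 0) : Hom (cone f) M where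
  app n := (g.app n).comp (AddMonoidHom.snd _ _)
  app_smul h b x := g.app_smul h b x.2
  comm {i j} h x := by
    subst h
    have key : ∀ (y : K.carrier (i + 1)) (z : L.carrier i),
        g.app (i + 1) (f.app (i + 1) y + L.d rfl z) = M.d rfl (g.app i z) := by
      intro y z
      rw [map_add, w, zero_add, g.comm]
    exact key x.1 x.2

/-- The totalization `Tot(K → L → M) = cone(cone(K → L) → M)` of a short exact sequence. -/
def tot {K L M : CDGModule.{u, v} C} (f : Hom K L) (g : Hom L M) (h : ShortExact f g) :
    CDGModule.{u, v} C :=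
  cone (coneDesc f g (fun n => (h.exact n).apply_apply_eq_zero))

/-- The direct sum of a family of CDG-modules, formed degreewise. -/
def directSum {ι : Type v} (M : ι → CDGModule.{u, v} C) : CDGModule.{u, v} C where
  carrier n := DirectSum ι (fun a => (M a).carrier n)
  smul {i j k} h := AddMonoidHom.mk' (fun b => DirectSum.map (fun a => (M a).smul h b))
    (fun b c => by ext; simp)
  one_smul x := DFinsupp.ext fun a => (M a).one_smul (x a)
  mul_smul h₁ h₂ h₃ h₄ b c x := DFinsupp.ext fun a => (M a).mul_smul h₁ h₂ h₃ h₄ b c (x a)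
  d h := DirectSum.map (fun a => (M a).d h)
  leibniz {i j k j' k'} h hj hk b x := DFinsupp.ext fun a => by
    refine ((M a).leibniz h hj hk b (x a)).trans (congrArg (_ + ·) ?_)
    exact (directSum_sign_apply (G := fun a => (M a).carrier k') i.negOnePow
      (DirectSum.map (fun a => (M a).smul (show i + j' = k' by omega) b)
        (DirectSum.map (fun a => (M a).d hj) x)) a).symm
  d_d h₁ h₂ x := DFinsupp.ext fun a => (M a).d_d h₁ h₂ (x a)

/-- The product of a family of CDG-modules, formed degreewise. -/
def product {ι : Type v} (M : ι → CDGModule.{u, v} C) : CDGModule.{u, v} C where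
  carrier n := ∀ a, (M a).carrier n
  smul {i j k} h := AddMonoidHom.mk'
    (fun b => AddMonoidHom.mk' (fun x a => (M a).smul h b (x a)) (fun x y => by ext; simp))
    (fun b c => by ext; simp)
  one_smul x := funext fun a => (M a).one_smul (x a)
  mul_smul h₁ h₂ h₃ h₄ b c x := funext fun a => (M a).mul_smul h₁ h₂ h₃ h₄ b c (x a)
  d h := AddMonoidHom.mk' (fun x a => (M a).d h (x a)) (fun x y => by ext; simp)
  leibniz h hj hk b x := funext fun a => (M a).leibniz h hj hk b (x a)
  d_d h₁ h₂ x := funext fun a => (M a).d_d h₁ h₂ (x a)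

/-- The class `P` of CDG-modules is (the class of objects of) a strictly full triangulated
subcategory of the homotopy category of CDG-modules: it contains the zero object and is closed
under isomorphisms in the homotopy category, under shifts in both directions, and under cones
of closed morphisms of degree `0`. -/
structure IsTriangulatedSubcategory (P : CDGModule.{u, v} C → Prop) : Prop where
  zero_mem : P (zero C)
  of_homotopyEquivalent : ∀ {M N}, HomotopyEquivalent M N → P M → P N
  shift_mem : ∀ {M} (a : ℤ), P M → P (M.shift a)
  cone_mem : ∀ {M N} (f : Hom M N), P M → P N → P (cone f)

/-- `P` contains the totalizations of all short exact sequences of CDG-modules. -/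
def ContainsTotalizations (P : CDGModule.{u, v} C → Prop) : Prop :=
  ∀ {K L M : CDGModule.{u, v} C} (f : Hom K L) (g : Hom L M) (h : ShortExact f g), P (tot f g h)

/-- A CDG-module is coacyclic if it belongs to the minimal triangulated subcategory of the
homotopy category of CDG-modules that contains the totalizations of short exact sequences and
is closed under infinite direct sums. -/
def IsCoacyclic (N : CDGModule.{u, v} C) : Prop :=
  ∀ P : CDGModule.{u, v} C → Prop, IsTriangulatedSubcategory P → ContainsTotalizations P →
    (∀ {ι : Type v} (M : ι → CDGModule.{u, v} C), (∀ a, P (M a)) → P (directSum M)) → P N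

/-- A CDG-module is contraacyclic if it belongs to the minimal triangulated subcategory of the
homotopy category of CDG-modules that contains the totalizations of short exact sequences and
is closed under infinite products. -/
def IsContraacyclic (Q : CDGModule.{u, v} C) : Prop :=
  ∀ P : CDGModule.{u, v} C → Prop, IsTriangulatedSubcategory P → ContainsTotalizations P →
    (∀ {ι : Type v} (M : ι → CDGModule.{u, v} C), (∀ a, P (M a)) → P (product M)) → P Q

/-- For graded submodules `K` and `K'` this says `d_M(K) ⊆ K'`. -/
def MapsInto (M : CDGModule.{u, v} C) (K K' : GrSubmodule M.toGrModule) : Prop :=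
  ∀ {i j : ℤ} (h : i + 1 = j) (x : M.carrier i), x ∈ K.comp i → M.d h x ∈ K'.comp j

/-- For graded submodules `L ⊆ K ⊆ K'` of `M` (the inclusions are not needed to write down the
map) with `d_M(L) ⊆ K` and `d_M(K) ⊆ K'`, the morphism
of graded `B`-modules `(K/L)[a] → (K'/K)[a+1]` induced by `d_M`. -/
def inducedMap (M : CDGModule.{u, v} C) {L K K' : GrSubmodule M.toGrModule}
    (hLd : M.MapsInto L K) (hKd : M.MapsInto K K')
    {a a' : ℤ} (ha : a + 1 = a') :
    GrHom ((K.subquotient L).shift a) ((K'.subquotient K).shift a') where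
  app n := QuotientAddGroup.map _ _
    (((M.d (show n + a + 1 = n + a' by omega)).comp (K.comp (n + a)).subtype).codRestrict
      (K'.comp (n + a')) (fun x => hKd _ _ x.2))
    (fun x hx => by
      rw [AddSubgroup.mem_comap, AddSubgroup.mem_addSubgroupOf]
      exact hLd _ _ (AddSubgroup.mem_addSubgroupOf.1 hx))
  app_smul {i j k} h b x := by
    subst ha
    obtain ⟨x⟩ := x
    have key : ∀ (y : K.comp (j + a)) (u : K.comp (k + a)) (z : K'.comp (j + (a + 1)))
        (w : K'.comp (k + (a + 1))),
        (u : M.carrier (k + a)) = M.smul (show i + (j + a) = k + a by omega) b y →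
        (z : M.carrier (j + (a + 1))) = M.d (by omega) (y : M.carrier (j + a)) →
        (w : M.carrier (k + (a + 1))) =
          M.smul (show i + (j + (a + 1)) = k + (a + 1) by omega) b z →
        QuotientAddGroup.map ((L.comp (k + a)).addSubgroupOf (K.comp (k + a)))
          ((K.comp (k + (a + 1))).addSubgroupOf (K'.comp (k + (a + 1))))
          (((M.d (show k + a + 1 = k + (a + 1) by omega)).comp
            (K.comp (k + a)).subtype).codRestrict (K'.comp (k + (a + 1)))
              (fun x => hKd _ _ x.2))
          (fun x hx => by
            rw [AddSubgroup.mem_comap, AddSubgroup.mem_addSubgroupOf]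
            exact hLd _ _ (AddSubgroup.mem_addSubgroupOf.1 hx))
          ((a * i).negOnePow • (QuotientAddGroup.mk u : K.comp (k + a) ⧸ _)) =
        ((a + 1) * i).negOnePow • (QuotientAddGroup.mk w : K'.comp (k + (a + 1)) ⧸ _) := by
      intro y u z w hu hz hw
      rw [map_sign, add_mul, Int.negOnePow_add, one_mul, ← smul_smul]
      congr 1
      rw [← QuotientAddGroup.mk'_apply, ← QuotientAddGroup.mk'_apply, ← map_sign,
        QuotientAddGroup.mk'_apply, QuotientAddGroup.mk'_apply, QuotientAddGroup.map_mk]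
      refine Eq.symm (QuotientAddGroup.eq.2 ?_)
      rw [AddSubgroup.mem_addSubgroupOf]
      have e : ((-(i.negOnePow • w) +
          ((M.d (show k + a + 1 = k + (a + 1) by omega)).comp
            (K.comp (k + a)).subtype).codRestrict (K'.comp (k + (a + 1)))
              (fun x => hKd _ _ x.2) u : K'.comp (k + (a + 1))) : M.carrier (k + (a + 1))) =
          M.smul (show i + 1 + (j + a) = k + (a + 1) by omega) (C.dHom b) y := by
        rw [AddSubgroup.coe_add, AddSubgroup.coe_neg,
          show ((i.negOnePow • w : K'.comp (k + (a + 1))) : M.carrier (k + (a + 1))) =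
            i.negOnePow • (w : M.carrier (k + (a + 1))) from
              map_sign (K'.comp (k + (a + 1))).subtype _ w]
        change -(i.negOnePow • (w : M.carrier (k + (a + 1)))) +
          M.d (show k + a + 1 = k + (a + 1) by omega) (u : M.carrier (k + a)) = _
        rw [hu, hw, hz, M.leibniz (show i + (j + a) = k + a by omega)
          (show j + a + 1 = j + (a + 1) by omega) (show k + a + 1 = k + (a + 1) by omega) b]
        abel
      rw [e]
      exact K.smul_mem _ _ y.2
    exact key x _ _ _ rfl rfl rfl

end CDGModule

end Modules

end CDG

/-! For a graded submodule F of N put Z_F = {z ∈ F | dz ∈ F}, the largest CDG-submodule inside F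
(`interior`), and inside the contractible module cone(id_N) put W_F = {(y, z) | z ∈ F, y + dz ∈ F}
(`interiorCone`). The standard contraction (y, z) ↦ (z, 0) preserves W_F, so both W_F and
cone(id_N)/W_F are contractible, whatever F is.

The preimage of W_F under N → cone(id_N) is Z_F. Its image in N[1] consists of the y with y + dz ∈ F
for some z ∈ F. If F + dF ⊆ F', this image lies in Z_{F'}, and it is all of Z_{F'} exactly under the
condition recorded in `IsInteriorStep`. For consecutive filtration steps that condition follows from
acyclicity of the complex: an element of Z_{F'} represents a cocycle in F'/F, and writing the
cocycle as a coboundary produces z. So 0 → N → cone(id_N) → N[1] → 0 induces short exact sequences 0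
→ Z_F → W_F → Z_{F'}[1] → 0 and 0 → N/Z_F → cone(id_N)/W_F → (N/Z_{F'})[1] → 0, whose middle terms
are contractible.

In (a), Z_{F_0} = 0, and the first sequence carries membership in P from Z_{F_i} to Z_{F_{i+1}}.
Since F_i ⊆ Z_{F_{i+1}}, the Z_{F_i} exhaust N, and the telescope 0 → ⊕ Z_{F_i} → ⊕ Z_{F_i} → N → 0
finishes. In (b), N/Z_{F^0} = 0, and the second sequence carries membership from N/Z_{F^i} to
N/Z_{F^{i+1}}. Completeness makes N the limit of the N/Z_{F^i}, and 0 → N → ∏ N/Z_{F^i} → ∏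
N/Z_{F^i} → 0 finishes. -/

namespace CDG

namespace CDGModule

variable {B : Type u} [Ring B] {𝓑 : ℤ → AddSubgroup B} [GradedRing 𝓑] {C : CDGRing 𝓑}

/-! ### Morphisms and their factorizations -/

/-- The zero morphism. -/
def Hom.zero (M N : CDGModule.{u, v} C) : Hom M N where
  app _ := 0
  app_smul h b x := by simp
  comm h x := by simp

/-- The shift of a morphism. -/
def Hom.shift {M N : CDGModule.{u, v} C} (f : Hom M N) (a : ℤ) : Hom (M.shift a) (N.shift a) where
  app n := f.app (n + a)
  app_smul {i j k} h b x := by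
    have key : ∀ y : M.carrier (j + a),
        f.app (k + a) ((a * i).negOnePow • M.smul (show i + (j + a) = k + a by omega) b y) =
          (a * i).negOnePow • N.smul (show i + (j + a) = k + a by omega) b (f.app (j + a) y) := by
      intro y
      rw [map_sign, f.app_smul]
    exact key x
  comm {i j} h x := by
    have key : ∀ y : M.carrier (i + a),
        f.app (j + a) (a.negOnePow • M.d (show i + a + 1 = j + a by omega) y) =
          a.negOnePow • N.d (show i + a + 1 = j + a by omega) (f.app (i + a) y) := by
      intro y
      rw [map_sign, f.comm]
    exact key x

/-- A morphism into `M` whose values lie in the image of an injective morphism `j` factors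
through `j`. -/
theorem Hom.exists_lift {K L M : CDGModule.{u, v} C} (j : Hom K M)
    (hj : ∀ n, Function.Injective (j.app n)) (f : Hom L M)
    (h : ∀ n x, ∃ y, j.app n y = f.app n x) :
    ∃ g : Hom L K, ∀ n x, j.app n (g.app n x) = f.app n x := by
  choose g hg using h
  refine ⟨{ app := fun n => AddMonoidHom.mk' (g n) fun x y => hj n ?_,
            app_smul := fun {i _ k} h b x => hj k ?_,
            comm := fun {i k} h x => hj k ?_ }, hg⟩
  · simp only [map_add, hg]
  · simp only [AddMonoidHom.mk'_apply, j.app_smul, f.app_smul, hg]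
  · simp only [AddMonoidHom.mk'_apply, j.comm, f.comm, hg]

/-- A morphism vanishing on the kernel of a surjective morphism `q` factors through `q`. -/
theorem Hom.exists_desc {L M N : CDGModule.{u, v} C} (q : Hom M N)
    (hq : ∀ n, Function.Surjective (q.app n)) (f : Hom M L)
    (h : ∀ n x, q.app n x = 0 → f.app n x = 0) :
    ∃ g : Hom N L, ∀ n x, g.app n (q.app n x) = f.app n x := by
  choose r hr using hq
  have hf : ∀ n x y, q.app n x = q.app n y → f.app n x = f.app n y := fun n x y hxy => by
    rw [← sub_eq_zero, ← map_sub]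
    exact h n _ (by rw [map_sub, hxy, sub_self])
  refine ⟨{ app := fun n => AddMonoidHom.mk' (fun x => f.app n (r n x)) fun x y => ?_,
            app_smul := fun {i _ k} h b x => ?_,
            comm := fun {i k} h x => ?_ }, fun n x => hf n _ _ (hr n _)⟩
  · rw [← map_add]
    exact hf n _ _ (by simp only [map_add, hr])
  · simp only [AddMonoidHom.mk'_apply]
    rw [← f.app_smul]
    exact hf k _ _ (by simp only [q.app_smul, hr])
  · simp only [AddMonoidHom.mk'_apply]
    rw [← f.comm]
    exact hf k _ _ (by simp only [q.comm, hr])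

/-! ### Homotopies and contractible CDG-modules -/

/-- The negative of a homotopy is a homotopy in the opposite direction. -/
def Homotopy.symm {M N : CDGModule.{u, v} C} {f g : Hom M N} (H : Homotopy f g) :
    Homotopy g f where
  s h := -H.s h
  s_smul h hj hk b x := by
    simp only [AddMonoidHom.neg_apply, H.s_smul h hj hk, map_neg, smul_neg]
  sub_eq h₁ h₂ x := by
    simp only [AddMonoidHom.neg_apply, map_neg]
    rw [← neg_add, ← H.sub_eq h₁ h₂, neg_sub]

/-- A CDG-module is contractible if its identity morphism is homotopic to zero. -/
def IsContractible (M : CDGModule.{u, v} C) : Prop :=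
  Nonempty (Homotopy (Hom.id M) (Hom.zero M M))

theorem IsContractible.homotopyEquivalent_zero {M : CDGModule.{u, v} C} (h : M.IsContractible) :
    HomotopyEquivalent (zero C) M := by
  obtain ⟨H⟩ := h
  exact ⟨Hom.zero _ _, Hom.zero _ _, ⟨⟨fun _ => 0, fun _ _ _ _ _ => rfl, fun _ _ _ => rfl⟩⟩,
    ⟨H.symm⟩⟩

/-- A submodule preserved by a contracting homotopy is contractible. -/
theorem IsContractible.of_injective {K M : CDGModule.{u, v} C}
    (H : Homotopy (Hom.id M) (Hom.zero M M)) (j : Hom K M)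
    (hj : ∀ n, Function.Injective (j.app n))
    (h : ∀ {m n : ℤ} (e : n + 1 = m) (x : K.carrier m), ∃ y, j.app n y = H.s e (j.app m x)) :
    K.IsContractible := by
  choose s hs using @h
  refine ⟨⟨fun {m n} e => AddMonoidHom.mk' (s e) fun x y => hj n ?_,
    fun {i j' k a c} e₁ e₂ e₃ b x => hj c ?_, fun {i j' k} e₁ e₂ x => hj j' ?_⟩⟩
  · simp only [map_add, hs]
  · simp only [AddMonoidHom.mk'_apply, hs, map_sign, j.app_smul, H.s_smul e₁ e₂ e₃]
  · have := H.sub_eq e₁ e₂ (j.app j' x)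
    simp only [AddMonoidHom.mk'_apply, map_add, hs, j.comm, ← this]
    change j.app j' (x - 0) = j.app j' x - 0
    simp

/-- A quotient by a submodule preserved by a contracting homotopy is contractible. -/
theorem IsContractible.of_surjective {M N : CDGModule.{u, v} C}
    (H : Homotopy (Hom.id M) (Hom.zero M M)) (q : Hom M N)
    (hq : ∀ n, Function.Surjective (q.app n))
    (h : ∀ {m n : ℤ} (e : n + 1 = m) (x : M.carrier m), q.app m x = 0 →
      q.app n (H.s e x) = 0) :
    N.IsContractible := by
  choose r hr using hq
  have hf : ∀ {m n : ℤ} (e : n + 1 = m) (x y : M.carrier m), q.app m x = q.app m y →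
      q.app n (H.s e x) = q.app n (H.s e y) := fun e x y hxy => by
    rw [← sub_eq_zero, ← map_sub, ← map_sub]
    exact h e _ (by rw [map_sub, hxy, sub_self])
  refine ⟨⟨fun {m n} e => AddMonoidHom.mk' (fun x => q.app n (H.s e (r m x))) fun x y => ?_,
    fun {i j' k a c} e₁ e₂ e₃ b x => ?_, fun {i j' k} e₁ e₂ x => ?_⟩⟩
  · rw [← map_add, ← map_add]
    exact hf e _ _ (by simp only [map_add, hr])
  · simp only [AddMonoidHom.mk'_apply]
    rw [← q.app_smul, ← map_sign, ← H.s_smul e₁ e₂ e₃]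
    exact hf e₃ _ _ (by simp only [q.app_smul, hr])
  · have := congrArg (q.app j') (H.sub_eq e₁ e₂ (r j' x))
    have e : q.app j' (H.s e₂ (r k (N.d e₂ x))) = q.app j' (H.s e₂ (M.d e₂ (r j' x))) :=
      hf e₂ _ _ (by simp only [q.comm, hr])
    simp only [AddMonoidHom.mk'_apply, e]
    rw [← q.comm, ← map_add, ← this]
    change x - 0 = q.app j' (r j' x - 0)
    rw [sub_zero, sub_zero, hr]

/-! ### Cones and the rotation of triangles -/

/-- The canonical morphism `L → cone f`. -/
def coneInr {K L : CDGModule.{u, v} C} (f : Hom K L) : Hom L (cone f) where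
  app n := AddMonoidHom.inr ((K.shift 1).carrier n) (L.carrier n)
  app_smul {i j k} h b x := Prod.ext (map_zero ((K.shift 1).smul h b)).symm rfl
  comm {i j} h x := by
    subst h
    refine Prod.ext (map_zero ((K.shift 1).d rfl)).symm ?_
    have key : L.d rfl x = f.app (i + 1) 0 + L.d rfl x := by rw [map_zero, zero_add]
    exact key

/-- The canonical morphism `cone f → K[1]`. -/
def coneFst {K L : CDGModule.{u, v} C} (f : Hom K L) : Hom (cone f) (K.shift 1) where
  app n := AddMonoidHom.fst ((K.shift 1).carrier n) (L.carrier n)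
  app_smul _ _ _ := rfl
  comm _ _ := rfl

/-- For f the identity of N this is the ambient sequence whose induced sequences of submodules and
of quotients drive both inductions. -/
theorem coneInr_shortExact {K L : CDGModule.{u, v} C} (f : Hom K L) :
    ShortExact (coneInr f) (coneFst f) where
  injective n _ _ h := congrArg Prod.snd h
  exact n x := ⟨fun h => ⟨x.2, Prod.ext (Eq.symm h) rfl⟩, by rintro ⟨y, rfl⟩; rfl⟩
  surjective n x := ⟨(x, 0), rfl⟩

theorem neg_one_pow_smul {G : Type*} [AddCommGroup G] (x : G) : (1 : ℤ).negOnePow • x = -x := by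
  simp

theorem sign_smul_zero {G : Type*} [AddCommGroup G] (e : ℤˣ) : (0 : G) = e • 0 :=
  (smul_zero e).symm

/-- The contracting homotopy `(x, y) ↦ (y, 0)` of the cone of an identity morphism. -/
def coneIdHomotopy (M : CDGModule.{u, v} C) :
    Homotopy (Hom.id (cone (Hom.id M))) (Hom.zero _ _) where
  s {i j} h := h ▸ (AddMonoidHom.inl (M.carrier (j + 1)) (M.carrier j)).comp
    (AddMonoidHom.snd ((M.shift 1).carrier (j + 1)) (M.carrier (j + 1)))
  s_smul {i j k j' k'} h hj hk b x := by
    subst hj hk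
    have key : ∀ z : M.carrier (j' + 1), ((M.smul h b z, 0) :
        M.carrier (k' + 1) × M.carrier k') =
          i.negOnePow • (((1 * i).negOnePow • M.smul (show i + (j' + 1) = k' + 1 by omega) b z,
            M.smul (show i + j' = k' by omega) b 0) : M.carrier (k' + 1) × M.carrier k') := by
      intro z
      refine Prod.ext ?_ ?_
      -- The action on the shifted summand carries the sign (-1)^{|b|}, which cancels the sign in
      -- the linearity rule for maps of degree -1.
      · rw [one_mul]
        change M.smul h b z = i.negOnePow • i.negOnePow • M.smul h b z
        rw [smul_smul, Int.units_mul_self, one_smul]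
      · change (0 : M.carrier k') = i.negOnePow • M.smul (show i + j' = k' by omega) b 0
        rw [map_zero, smul_zero]
    exact key x.2
  sub_eq {i j k} h₁ h₂ x := by
    subst h₁ h₂
    have key : ∀ (y : M.carrier (i + 1 + 1)) (z : M.carrier (i + 1)),
        ((y, z) : M.carrier (i + 1 + 1) × M.carrier (i + 1)) - 0 =
          ((1 : ℤ).negOnePow • M.d rfl z, z + M.d rfl 0) + (y + M.d rfl z, 0) := by
      intro y z
      rw [neg_one_pow_smul]
      refine Prod.ext ?_ ?_ <;> simp
    exact key x.1 x.2

/-- The morphism `X[1] → cone (Y → cone g)`, `x ↦ (-g x, x, 0)`. -/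
def shiftToConeInr {X Y : CDGModule.{u, v} C} (g : Hom X Y) :
    Hom (X.shift 1) (cone (coneInr g)) where
  app n := AddMonoidHom.prod (-(g.shift 1).app n)
    (AddMonoidHom.prod (AddMonoidHom.id (X.carrier (n + 1))) 0)
  app_smul {i j k} h b x := by
    refine Prod.ext ?_ (Prod.ext rfl (map_zero (Y.smul h b)).symm)
    have key := (g.shift 1).app_smul h b x
    exact (congrArg Neg.neg key).trans (map_neg ((Y.shift 1).smul h b) _).symm
  comm {i j} h x := by
    subst h
    have key : ∀ y : X.carrier (i + 1),
        ((-(g.app (i + 1 + 1) ((1 : ℤ).negOnePow • X.d rfl y)),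
          ((1 : ℤ).negOnePow • X.d rfl y, 0)) :
            Y.carrier (i + 1 + 1) × X.carrier (i + 1 + 1) × Y.carrier (i + 1)) =
        ((1 : ℤ).negOnePow • Y.d rfl (-g.app (i + 1) y),
          (0, -g.app (i + 1) y) + ((1 : ℤ).negOnePow • X.d rfl y, g.app (i + 1) y + Y.d rfl 0)) := by
      intro y
      simp only [neg_one_pow_smul]
      refine Prod.ext ?_ (Prod.ext ?_ ?_) <;> simp [g.comm]
    exact key x

/-- The morphism `cone (Y → cone g) → X[1]`. -/
def coneInrToShift {X Y : CDGModule.{u, v} C} (g : Hom X Y) :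
    Hom (cone (coneInr g)) (X.shift 1) where
  app n := (AddMonoidHom.fst (X.carrier (n + 1)) (Y.carrier n)).comp
    (AddMonoidHom.snd (Y.carrier (n + 1)) (X.carrier (n + 1) × Y.carrier n))
  app_smul h b x := rfl
  comm {i j} h x := by
    subst h
    exact zero_add ((X.shift 1).d rfl x.2.1)

/-- On triples (y', x, y) the two copies of Y are cancelled by the homotopy (y', x, y) ↦ (y, 0, 0),
which leaves X[1]. The composite X[1] → X[1] is the identity on the nose, so the zero homotopy
serves there. -/
theorem homotopyEquivalent_cone_coneInr {X Y : CDGModule.{u, v} C} (g : Hom X Y) :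
    HomotopyEquivalent (cone (coneInr g)) (X.shift 1) := by
  refine ⟨coneInrToShift g, shiftToConeInr g, ⟨Homotopy.symm ⟨fun {i j} h => h ▸
    (AddMonoidHom.inl (Y.carrier (j + 1)) (X.carrier (j + 1) × Y.carrier j)).comp
    ((AddMonoidHom.snd (X.carrier (j + 1 + 1)) (Y.carrier (j + 1))).comp
      (AddMonoidHom.snd (Y.carrier (j + 1 + 1)) (X.carrier (j + 1 + 1) × Y.carrier (j + 1)))),
    ?_, ?_⟩⟩, ⟨⟨fun _ => 0, ?_, ?_⟩⟩⟩
  · intro i j k j' k' h hj hk b x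
    subst hj hk
    have key : ∀ z : Y.carrier (j' + 1), ((Y.smul h b z, (0, 0)) :
        Y.carrier (k' + 1) × X.carrier (k' + 1) × Y.carrier k') =
          i.negOnePow • (((1 * i).negOnePow • Y.smul (show i + (j' + 1) = k' + 1 by omega) b z,
            ((1 * i).negOnePow • X.smul (show i + (j' + 1) = k' + 1 by omega) b 0,
            Y.smul (show i + j' = k' by omega) b 0)) :
              Y.carrier (k' + 1) × X.carrier (k' + 1) × Y.carrier k') := by
      intro z
      rw [one_mul, map_zero, map_zero, smul_zero]
      refine Prod.ext ?_ (Prod.ext (sign_smul_zero i.negOnePow) (sign_smul_zero i.negOnePow))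
      change Y.smul h b z = i.negOnePow • i.negOnePow • Y.smul h b z
      rw [smul_smul, Int.units_mul_self, one_smul]
    exact key x.2.2
  · intro i j k h₁ h₂ x
    subst h₁ h₂
    have key : ∀ (y' : Y.carrier (i + 1 + 1)) (x : X.carrier (i + 1 + 1)) (y : Y.carrier (i + 1)),
        (y', (x, y)) -
          ((-g.app _ x, (x, 0)) :
            Y.carrier (i + 1 + 1) × X.carrier (i + 1 + 1) × Y.carrier (i + 1)) =
        ((1 : ℤ).negOnePow • Y.d rfl y,
          (0, y) + ((1 : ℤ).negOnePow • X.d rfl 0, g.app (i + 1) 0 + Y.d rfl 0)) +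
        (y' + (g.app _ x + Y.d rfl y), (0, 0)) := by
      intro y' x y
      rw [neg_one_pow_smul, neg_one_pow_smul]
      refine Prod.ext ?_ (Prod.ext ?_ ?_)
      · simp
        abel
      all_goals simp
    exact key x.1 x.2.1 x.2.2
  · intro i j k j' k' h hj hk b x
    change 0 = i.negOnePow • ((X.shift 1).smul _ b) 0
    rw [map_zero, smul_zero]
  · intro i j k h₁ h₂ x
    have e := map_zero ((X.shift 1).d h₁)
    change x - x = (X.shift 1).d h₁ 0 + 0
    rw [e, sub_self, add_zero]

/-- The morphism `Y[1] → cone (cone g → X[1])`, `y ↦ ((0, y), 0)`. -/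
def shiftToConeFst {X Y : CDGModule.{u, v} C} (g : Hom X Y) :
    Hom (Y.shift 1) (cone (coneFst g)) where
  app n := (AddMonoidHom.inl (X.carrier (n + 1 + 1) × Y.carrier (n + 1)) (X.carrier (n + 1))).comp
    (AddMonoidHom.inr (X.carrier (n + 1 + 1)) (Y.carrier (n + 1)))
  app_smul {i j k} h b x := by
    have key : ∀ y : Y.carrier (j + 1),
        (((0, (1 * i).negOnePow • Y.smul (show i + (j + 1) = k + 1 by omega) b y), 0) :
          (X.carrier (k + 1 + 1) × Y.carrier (k + 1)) × X.carrier (k + 1)) =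
        ((1 * i).negOnePow • ((1 * i).negOnePow • X.smul
            (show i + (j + 1 + 1) = k + 1 + 1 by omega) b 0,
            Y.smul (show i + (j + 1) = k + 1 by omega) b y),
          (1 * i).negOnePow • X.smul (show i + (j + 1) = k + 1 by omega) b 0) := by
      intro y
      rw [map_zero, map_zero, smul_zero, smul_zero]
      exact Prod.ext (Prod.ext (sign_smul_zero (1 * i).negOnePow) rfl) rfl
    exact key x
  comm {i j} h x := by
    subst h
    have key : ∀ y : Y.carrier (i + 1),
        (((0, (1 : ℤ).negOnePow • Y.d rfl y), 0) :
          (X.carrier (i + 1 + 1 + 1) × Y.carrier (i + 1 + 1)) × X.carrier (i + 1 + 1)) =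
        ((1 : ℤ).negOnePow • ((1 : ℤ).negOnePow • X.d rfl 0, g.app (i + 1 + 1) 0 + Y.d rfl y),
          0 + (1 : ℤ).negOnePow • X.d rfl 0) := by
      intro y
      simp only [neg_one_pow_smul]
      refine Prod.ext (Prod.ext ?_ ?_) ?_ <;> simp
    exact key x

/-- The morphism `cone (cone g → X[1]) → Y[1]`, `((x, y), x') ↦ y + g x'`. -/
def coneFstToShift {X Y : CDGModule.{u, v} C} (g : Hom X Y) :
    Hom (cone (coneFst g)) (Y.shift 1) where
  app n := AddMonoidHom.coprod (AddMonoidHom.snd (X.carrier (n + 1 + 1)) (Y.carrier (n + 1)))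
    (g.app (n + 1))
  app_smul {i j k} h b x := by
    have key : ∀ (y : Y.carrier (j + 1)) (x' : X.carrier (j + 1)),
        (1 * i).negOnePow • Y.smul (show i + (j + 1) = k + 1 by omega) b y +
          g.app (k + 1) ((1 * i).negOnePow • X.smul (show i + (j + 1) = k + 1 by omega) b x') =
        (1 * i).negOnePow • Y.smul (show i + (j + 1) = k + 1 by omega) b (y + g.app (j + 1) x') := by
      intro y x'
      rw [map_sign, g.app_smul, map_add, smul_add]
    exact key x.1.2 x.2
  comm {i j} h x := by
    subst h
    have key : ∀ (x : X.carrier (i + 1 + 1)) (y : Y.carrier (i + 1)) (x' : X.carrier (i + 1)),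
        (1 : ℤ).negOnePow • (g.app (i + 1 + 1) x + Y.d rfl y) +
          g.app (i + 1 + 1) (x + (1 : ℤ).negOnePow • X.d rfl x') =
        (1 : ℤ).negOnePow • Y.d rfl (y + g.app (i + 1) x') := by
      intro x y x'
      simp only [neg_one_pow_smul, map_add, map_neg, g.comm]
      abel
    exact key x.1.1 x.1.2 x.2

/-- Now the two copies of X cancel, through the homotopy ((x, y), x') ↦ ((x', 0), 0), which leaves
Y[1]. Again the other composite is strictly the identity. -/
theorem homotopyEquivalent_cone_coneFst {X Y : CDGModule.{u, v} C} (g : Hom X Y) :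
    HomotopyEquivalent (cone (coneFst g)) (Y.shift 1) := by
  refine ⟨coneFstToShift g, shiftToConeFst g, ⟨Homotopy.symm ⟨fun {i j} h => h ▸
    (AddMonoidHom.inl (X.carrier (j + 1 + 1) × Y.carrier (j + 1)) (X.carrier (j + 1))).comp
    ((AddMonoidHom.inl (X.carrier (j + 1 + 1)) (Y.carrier (j + 1))).comp
      (AddMonoidHom.snd (X.carrier (j + 1 + 1 + 1) × Y.carrier (j + 1 + 1))
        (X.carrier (j + 1 + 1)))), ?_, ?_⟩⟩, ⟨⟨fun _ => 0, ?_, ?_⟩⟩⟩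
  · intro i j k j' k' h hj hk b x
    subst hj hk
    have key : ∀ z : X.carrier (j' + 1 + 1),
        ((((1 * i).negOnePow • X.smul (show i + (j' + 1 + 1) = k' + 1 + 1 by omega) b z, 0), 0) :
          (X.carrier (k' + 1 + 1) × Y.carrier (k' + 1)) × X.carrier (k' + 1)) =
          i.negOnePow • (((1 * i).negOnePow •
            ((1 * i).negOnePow • X.smul (show i + (j' + 1 + 1) = k' + 1 + 1 by omega) b z,
              Y.smul (show i + (j' + 1) = k' + 1 by omega) b 0),
            (1 * i).negOnePow • X.smul (show i + (j' + 1) = k' + 1 by omega) b 0) :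
              (X.carrier (k' + 1 + 1) × Y.carrier (k' + 1)) × X.carrier (k' + 1)) := by
      intro z
      rw [one_mul, map_zero, map_zero, smul_zero]
      refine Prod.ext (Prod.ext ?_ ?_) (sign_smul_zero i.negOnePow)
      · change i.negOnePow • X.smul (show i + (j' + 1 + 1) = k' + 1 + 1 by omega) b z =
          i.negOnePow • i.negOnePow • i.negOnePow •
            X.smul (show i + (j' + 1 + 1) = k' + 1 + 1 by omega) b z
        rw [smul_smul, Int.units_mul_self, one_smul]
      · exact ((congrArg (i.negOnePow • ·) (smul_zero i.negOnePow)).trans (smul_zero _)).symm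
    exact key x.2
  · intro i j k h₁ h₂ x
    subst h₁ h₂
    have key : ∀ (x : X.carrier (i + 1 + 1 + 1)) (y : Y.carrier (i + 1 + 1))
        (x' : X.carrier (i + 1 + 1)),
        (((x, y), x') - ((0, y + g.app _ x'), 0) :
            (X.carrier (i + 1 + 1 + 1) × Y.carrier (i + 1 + 1)) × X.carrier (i + 1 + 1)) =
        ((1 : ℤ).negOnePow • ((1 : ℤ).negOnePow • X.d rfl x', g.app _ x' + Y.d rfl 0),
          x' + (1 : ℤ).negOnePow • X.d rfl 0) +
        ((x + (1 : ℤ).negOnePow • X.d rfl x', 0), 0) := by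
      intro x y x'
      simp only [neg_one_pow_smul]
      refine Prod.ext (Prod.ext ?_ ?_) ?_
      all_goals simp
    exact key x.1.1 x.1.2 x.2
  · intro i j k j' k' h hj hk b x
    change 0 = i.negOnePow • ((Y.shift 1).smul _ b) 0
    rw [map_zero, smul_zero]
  · intro i j k h₁ h₂ x
    have e := map_zero ((Y.shift 1).d h₁)
    have key : ∀ y : Y.carrier (j + 1), y + g.app (j + 1) 0 - y = 0 := by
      intro y
      rw [map_zero, add_zero, sub_self]
    change _ = (Y.shift 1).d h₁ 0 + 0
    rw [e, add_zero]
    exact key x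

/-- The identification of components of equal degrees, written as the action of the unit. -/
theorem smul_one_bijective (M : GrModule.{u, v} 𝓑) {i j : ℤ} (h : 0 + i = j) :
    Function.Bijective (M.smul h (one 𝓑)) := by
  obtain rfl : i = j := by omega
  have : ⇑(M.smul h (one 𝓑)) = id := funext M.one_smul
  rw [this]
  exact Function.bijective_id

/-- `M[1][-1]` is isomorphic to `M`. -/
theorem homotopyEquivalent_shift_shift_neg (M : CDGModule.{u, v} C) :
    HomotopyEquivalent ((M.shift 1).shift (-1)) M := by
  have e : ∀ n : ℤ, n + -1 + 1 = n := fun n => by omega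
  have hs : ∀ (i : ℤ) {j k : ℤ} (h : i + j = k) (b : 𝓑 i) (x : M.carrier j) (j' k' : ℤ)
    (hj : 0 + j = j') (hk : 0 + k = k') (h' : i + j' = k'),
    M.smul hk (one 𝓑) (M.smul h b x) = M.smul h' b (M.smul hj (one 𝓑) x) := by
    intro i j k h b x j' k' hj hk h'
    obtain rfl : j = j' := by omega
    obtain rfl : k = k' := by omega
    rw [M.one_smul, M.one_smul]
  have hd : ∀ {j k j' k' : ℤ} (h : j + 1 = k) (x : M.carrier j)
    (hj : 0 + j = j') (hk : 0 + k = k') (h' : j' + 1 = k'),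
    M.smul hk (one 𝓑) (M.d h x) = M.d h' (M.smul hj (one 𝓑) x) := by
    intro j k j' k' h x hj hk h'
    obtain rfl : j = j' := by omega
    obtain rfl : k = k' := by omega
    rw [M.one_smul, M.one_smul]
  have hh : ∀ {i j : ℤ} (h : 0 + i = j) (h' : 0 + j = i) (x : M.carrier i),
    M.smul h' (one 𝓑) (M.smul h (one 𝓑) x) = x := by
    intro i j h h' x
    obtain rfl : i = j := by omega
    rw [M.one_smul, M.one_smul]
  let f : Hom ((M.shift 1).shift (-1)) M :=
    { app := fun n => M.smul (show 0 + (n + -1 + 1) = n by omega) (one 𝓑)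
      app_smul := fun {i j k} h b x => by
        have key : ∀ y : M.carrier (j + -1 + 1),
          M.smul (show 0 + (k + -1 + 1) = k by omega) (one 𝓑)
            ((-1 * i).negOnePow • (1 * i).negOnePow •
              M.smul (show i + (j + -1 + 1) = k + -1 + 1 by omega) b y) =
          M.smul h b (M.smul (show 0 + (j + -1 + 1) = j by omega) (one 𝓑) y) := by
          intro y
          rw [one_mul, neg_one_mul, Int.negOnePow_neg, smul_smul, Int.units_mul_self, one_smul]
          exact hs _ _ _ _ _ _ _ _ _
        exact key x
      comm := fun {j k} h x => by
        have key : ∀ y : M.carrier (j + -1 + 1),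
          M.smul (show 0 + (k + -1 + 1) = k by omega) (one 𝓑)
            ((-1 : ℤ).negOnePow • (1 : ℤ).negOnePow •
              M.d (show (j + -1 + 1) + 1 = k + -1 + 1 by omega) y) =
          M.d h (M.smul (show 0 + (j + -1 + 1) = j by omega) (one 𝓑) y) := by
          intro y
          rw [Int.negOnePow_neg, smul_smul, Int.units_mul_self, one_smul]
          exact hd _ _ _ _ _
        exact key x }
  have hf : ∀ n, Function.Bijective (f.app n) := fun n => smul_one_bijective M.toGrModule _
  obtain ⟨g, hg⟩ := f.exists_lift (fun n => (hf n).1) (Hom.id M) fun n x => (hf n).2 x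
  refine ⟨f, g, ⟨⟨fun _ => 0, fun _ _ _ _ _ => ?_, fun _ _ x => ?_⟩⟩,
    ⟨⟨fun _ => 0, fun _ _ _ _ _ => ?_, fun _ _ x => ?_⟩⟩⟩
  · simp
  · simp only [AddMonoidHom.zero_apply, map_zero, add_zero]
    exact sub_eq_zero.2 ((hf _).1 (hg _ _))
  · simp
  · simp only [AddMonoidHom.zero_apply, map_zero, add_zero]
    exact sub_eq_zero.2 (hg _ _)

/-! ### Two out of three in a triangulated subcategory -/

namespace IsTriangulatedSubcategory

variable {P : CDGModule.{u, v} C → Prop} {K L M : CDGModule.{u, v} C} {f : Hom K L}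
  {g : Hom L M}

theorem of_isContractible (hP : IsTriangulatedSubcategory P) (h : K.IsContractible) : P K :=
  hP.of_homotopyEquivalent h.homotopyEquivalent_zero hP.zero_mem

theorem of_shift (hP : IsTriangulatedSubcategory P) (h : P (K.shift 1)) : P K :=
  hP.of_homotopyEquivalent (homotopyEquivalent_shift_shift_neg K) (hP.shift_mem (-1) h)

/-- Rotation: K[1] is homotopy equivalent to the cone of L → cone f, a morphism between objects of
P. -/
theorem of_cone_right (hP : IsTriangulatedSubcategory P) (h : P (cone f)) (hL : P L) : P K :=
  hP.of_shift (hP.of_homotopyEquivalent (homotopyEquivalent_cone_coneInr f)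
    (hP.cone_mem (coneInr f) hL h))

theorem of_cone_left (hP : IsTriangulatedSubcategory P) (h : P (cone f)) (hK : P K) : P L :=
  hP.of_shift (hP.of_homotopyEquivalent (homotopyEquivalent_cone_coneFst f)
    (hP.cone_mem (coneFst f) h (hP.shift_mem 1 hK)))

/-- The totalization is the cone of cone f → M, so modulo P a short exact sequence behaves like a
triangle, and two out of three for cones applies to M here and to K in the next lemma. -/
theorem right_of_shortExact (hP : IsTriangulatedSubcategory P)
    (hT : ContainsTotalizations P) (h : ShortExact f g) (hK : P K) (hL : P L) : P M :=
  hP.of_cone_left (hT f g h) (hP.cone_mem f hK hL)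

theorem left_of_shortExact (hP : IsTriangulatedSubcategory P)
    (hT : ContainsTotalizations P) (h : ShortExact f g) (hL : P L) (hM : P M) : P K :=
  hP.of_cone_right (hP.of_cone_right (hT f g h) hM) hL

end IsTriangulatedSubcategory

/-! ### CDG-submodules, quotients and induced short exact sequences -/

/-- A CDG-submodule: a graded submodule preserved by the differential. -/
structure CDGSubmodule (M : CDGModule.{u, v} C) extends GrSubmodule M.toGrModule where
  d_mem : M.MapsInto toGrSubmodule toGrSubmodule

namespace CDGSubmodule

variable {M : CDGModule.{u, v} C}

/-- A CDG-submodule as a CDG-module. -/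
def sub (K : CDGSubmodule M) : CDGModule.{u, v} C where
  carrier n := K.comp n
  smul {i j k} h := AddMonoidHom.mk'
    (fun b => ((M.smul h b).comp (K.comp j).subtype).codRestrict (K.comp k)
      (fun x => K.smul_mem h b x.2))
    (fun b c => by ext x; simp)
  one_smul {j} (x : K.comp j) := Subtype.ext (M.one_smul (x : M.carrier j))
  mul_smul {i j k ij jk ijk} h₁ h₂ h₃ h₄ b c (x : K.comp k) :=
    Subtype.ext (M.mul_smul h₁ h₂ h₃ h₄ b c (x : M.carrier k))
  d {i j} h := ((M.d h).comp (K.comp i).subtype).codRestrict (K.comp j)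
    (fun x => K.d_mem h _ x.2)
  leibniz {i j k j' k'} h hj hk b (x : K.comp j) := by
    refine Subtype.ext ((M.leibniz h hj hk b (x : M.carrier j)).trans (congrArg (_ + ·) ?_))
    exact (map_sign (K.comp k').subtype i.negOnePow
      ⟨_, K.smul_mem (show i + j' = k' by omega) b (K.d_mem hj _ x.2)⟩).symm
  d_d {i j k} h₁ h₂ (x : K.comp i) := Subtype.ext (M.d_d h₁ h₂ (x : M.carrier i))

/-- The inclusion of a CDG-submodule. -/
def incl (K : CDGSubmodule M) : Hom K.sub M where
  app n := (K.comp n).subtype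
  app_smul _ _ _ := rfl
  comm _ _ := rfl

theorem incl_injective (K : CDGSubmodule M) (n : ℤ) : Function.Injective (K.incl.app n) :=
  Subtype.val_injective

theorem exists_incl_eq (K : CDGSubmodule M) {n : ℤ} {x : M.carrier n} :
    (∃ y, K.incl.app n y = x) ↔ x ∈ K.comp n :=
  ⟨by rintro ⟨y, rfl⟩; exact Subtype.prop (p := (· ∈ K.comp n)) y,
    fun h => ⟨(⟨x, h⟩ : K.comp n), rfl⟩⟩

/-- The quotient by a CDG-submodule. -/
def quot (K : CDGSubmodule M) : CDGModule.{u, v} C where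
  carrier n := M.carrier n ⧸ K.comp n
  smul {i j k} h := AddMonoidHom.mk'
    (fun b => QuotientAddGroup.map _ _ (M.smul h b) (fun _ hx => K.smul_mem h b hx))
    (fun b c => by
      ext x
      exact congrArg QuotientAddGroup.mk (DFunLike.congr_fun (map_add (M.smul h) b c) x))
  one_smul x := by
    obtain ⟨x⟩ := x
    exact congrArg QuotientAddGroup.mk (M.one_smul x)
  mul_smul h₁ h₂ h₃ h₄ b c x := by
    obtain ⟨x⟩ := x
    exact congrArg QuotientAddGroup.mk (M.mul_smul h₁ h₂ h₃ h₄ b c x)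
  d {i j} h := QuotientAddGroup.map _ _ (M.d h) (fun _ hx => K.d_mem h _ hx)
  leibniz {i j k j' k'} h hj hk b x := by
    obtain ⟨x⟩ := x
    refine (congrArg QuotientAddGroup.mk (M.leibniz h hj hk b x)).trans ?_
    exact (map_add (QuotientAddGroup.mk' (K.comp k')) _ _).trans
      (congrArg (_ + ·) (map_sign (QuotientAddGroup.mk' (K.comp k')) _ _))
  d_d h₁ h₂ x := by
    obtain ⟨x⟩ := x
    exact congrArg QuotientAddGroup.mk (M.d_d h₁ h₂ x)

/-- The projection to the quotient by a CDG-submodule. -/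
def proj (K : CDGSubmodule M) : Hom M K.quot where
  app n := QuotientAddGroup.mk' (K.comp n)
  app_smul _ _ _ := rfl
  comm _ _ := rfl

theorem proj_surjective (K : CDGSubmodule M) (n : ℤ) : Function.Surjective (K.proj.app n) :=
  QuotientAddGroup.mk'_surjective _

theorem proj_eq_zero (K : CDGSubmodule M) {n : ℤ} {x : M.carrier n} :
    K.proj.app n x = 0 ↔ x ∈ K.comp n :=
  QuotientAddGroup.eq_zero_iff x

end CDGSubmodule

/-- A short exact sequence restricts to compatible submodules. -/
theorem ShortExact.exists_sub {K L M K' L' M' : CDGModule.{u, v} C} {f : Hom K L} {g : Hom L M}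
    (h : ShortExact f g) (a : Hom K' K) (b : Hom L' L) (c : Hom M' M)
    (ha : ∀ n, Function.Injective (a.app n)) (hb : ∀ n, Function.Injective (b.app n))
    (hc : ∀ n, Function.Injective (c.app n))
    (hf : ∀ n x, (∃ y, b.app n y = f.app n x) ↔ ∃ x', a.app n x' = x)
    (hg : ∀ n z, (∃ z', c.app n z' = z) ↔ ∃ y, g.app n (b.app n y) = z) :
    ∃ (f' : Hom K' L') (g' : Hom L' M'), ShortExact f' g' := by
  -- Viewing a, b, c as inclusions, `hf` says that K' is the preimage of L' under f, and `hg` that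
  -- M' is the image of L' under g. These are the conditions for the restricted sequence to stay
  -- exact.
  obtain ⟨f', hf'⟩ := b.exists_lift hb (f.comp a) fun n x => (hf n _).2 ⟨x, rfl⟩
  obtain ⟨g', hg'⟩ := c.exists_lift hc (g.comp b) fun n x => (hg n _).2 ⟨x, rfl⟩
  replace hf' : ∀ n x, b.app n (f'.app n x) = f.app n (a.app n x) := hf'
  replace hg' : ∀ n x, c.app n (g'.app n x) = g.app n (b.app n x) := hg'
  refine ⟨f', g', fun n x y hxy => ha n (h.injective n ?_), fun n y => ⟨fun hy => ?_, ?_⟩,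
    fun n z => ?_⟩
  · rw [← hf', ← hf', hxy]
  · obtain ⟨x, hx⟩ := (h.exact n _).1 ((hg' n y).symm.trans (by rw [hy, map_zero]))
    obtain ⟨x', rfl⟩ := (hf n x).1 ⟨y, hx.symm⟩
    exact ⟨x', hb n ((hf' n x').trans hx)⟩
  · rintro ⟨x, rfl⟩
    apply hc n
    rw [hg', hf', map_zero]
    exact (h.exact n).apply_apply_eq_zero _
  · obtain ⟨y, hy⟩ := (hg n _).1 ⟨z, rfl⟩
    exact ⟨y, hc n ((hg' n y).trans hy)⟩

/-- A short exact sequence descends to compatible quotients. -/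
theorem ShortExact.exists_quot {K L M K' L' M' : CDGModule.{u, v} C} {f : Hom K L} {g : Hom L M}
    (h : ShortExact f g) (a : Hom K K') (b : Hom L L') (c : Hom M M')
    (ha : ∀ n, Function.Surjective (a.app n)) (hb : ∀ n, Function.Surjective (b.app n))
    (hc : ∀ n, Function.Surjective (c.app n))
    (hf : ∀ n x, b.app n (f.app n x) = 0 ↔ a.app n x = 0)
    (hg : ∀ n z, c.app n z = 0 ↔ ∃ y, b.app n y = 0 ∧ g.app n y = z) :
    ∃ (f' : Hom K' L') (g' : Hom L' M'), ShortExact f' g' := by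
  -- The same two conditions, imposed on the kernels: ker a is the preimage of ker b, and ker c is
  -- its image.
  obtain ⟨f', hf'⟩ := a.exists_desc ha (b.comp f) fun n x hx => (hf n _).2 hx
  obtain ⟨g', hg'⟩ := b.exists_desc hb (c.comp g) fun n y hy => (hg n _).2 ⟨y, hy, rfl⟩
  replace hf' : ∀ n x, f'.app n (a.app n x) = b.app n (f.app n x) := hf'
  replace hg' : ∀ n x, g'.app n (b.app n x) = c.app n (g.app n x) := hg'
  refine ⟨f', g', fun n => (injective_iff_map_eq_zero _).2 fun x hx => ?_,
    fun n y => ⟨fun hy => ?_, ?_⟩, fun n z => ?_⟩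
  · obtain ⟨x, rfl⟩ := ha n x
    exact (hf n x).1 (by rw [← hf', hx])
  · obtain ⟨y, rfl⟩ := hb n y
    obtain ⟨y', hy', e⟩ := (hg n _).1 ((hg' n y).symm.trans hy)
    obtain ⟨x, hx⟩ := (h.exact n (y - y')).1 (by rw [map_sub, e, sub_self])
    exact ⟨a.app n x, by rw [hf', hx, map_sub, hy', sub_zero]⟩
  · rintro ⟨x, rfl⟩
    obtain ⟨x, rfl⟩ := ha n x
    rw [hf', hg', (h.exact n).apply_apply_eq_zero, map_zero]
  · obtain ⟨z, rfl⟩ := hc n z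
    obtain ⟨y, rfl⟩ := h.surjective n z
    exact ⟨b.app n y, hg' n y⟩

/-! ### The submodules Z_F and W_F and the inductive step -/

variable {N : CDGModule.{u, v} C}

/-- The largest CDG-submodule `{z ∈ F | d z ∈ F}` contained in a graded submodule `F`. -/
def interior (F : GrSubmodule N.toGrModule) : CDGSubmodule N where
  comp n := F.comp n ⊓ (F.comp (n + 1)).comap (N.d rfl)
  smul_mem {i j k} h b x hx := by
    refine ⟨F.smul_mem h b hx.1, ?_⟩
    change N.d rfl (N.smul h b x) ∈ F.comp (k + 1)
    rw [N.leibniz h rfl rfl]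
    refine add_mem (F.smul_mem _ _ hx.1) ?_
    rw [Units.smul_def]
    exact zsmul_mem (F.smul_mem _ _ hx.2) _
  d_mem {i j} h x hx := by
    subst h
    refine ⟨hx.2, ?_⟩
    change N.d rfl (N.d rfl x) ∈ F.comp (i + 1 + 1)
    -- d² is multiplication by the curvature, under which the graded submodule F is stable.
    rw [N.d_d]
    exact F.smul_mem _ _ hx.1

theorem mem_interior {F : GrSubmodule N.toGrModule} {n : ℤ} {x : N.carrier n} :
    x ∈ (interior F).comp n ↔ x ∈ F.comp n ∧ N.d rfl x ∈ F.comp (n + 1) :=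
  Iff.rfl

/-- The CDG-submodule of `cone (id : N → N)` which is cofreely cogenerated by a graded submodule
`F` of `N`: the pairs `(y, z)` with `z ∈ F` and `y + d z ∈ F`. -/
def interiorCone (F : GrSubmodule N.toGrModule) : CDGSubmodule (cone (Hom.id N)) where
  comp n := (F.comp n).comap (AddMonoidHom.snd (N.carrier (n + 1)) (N.carrier n)) ⊓
    (F.comp (n + 1)).comap (AddMonoidHom.coprod (AddMonoidHom.id (N.carrier (n + 1))) (N.d rfl))
  smul_mem {i j k} h b x hx := by
    refine ⟨F.smul_mem h b hx.1, ?_⟩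
    have key : ∀ (y : N.carrier (j + 1)) (z : N.carrier j), z ∈ F.comp j →
        y + N.d rfl z ∈ F.comp (j + 1) →
        (1 * i).negOnePow • N.smul (show i + (j + 1) = k + 1 by omega) b y +
          N.d rfl (N.smul h b z) ∈ F.comp (k + 1) := by
      intro y z hz hy
      -- By the Leibniz rule the sum equals d(b) z + (-1)^{|b|} b (y + dz), both of whose terms lie
      -- in F.
      rw [N.leibniz h rfl rfl, add_left_comm, one_mul, ← smul_add, ← map_add, Units.smul_def]
      exact add_mem (F.smul_mem _ _ hz) (zsmul_mem (F.smul_mem _ _ hy) _)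
    exact key x.1 x.2 hx.1 hx.2
  d_mem {i j} h x hx := by
    subst h
    refine ⟨hx.2, ?_⟩
    have key : ∀ (y : N.carrier (i + 1)) (z : N.carrier i), z ∈ F.comp i →
        (1 : ℤ).negOnePow • N.d rfl y + N.d rfl (y + N.d rfl z) ∈ F.comp (i + 1 + 1) := by
      intro y z hz
      rw [neg_one_pow_smul, map_add, neg_add_cancel_left, N.d_d]
      exact F.smul_mem _ _ hz
    exact key x.1 x.2 hx.1

theorem mem_interiorCone {F : GrSubmodule N.toGrModule} {n : ℤ} {y : N.carrier (n + 1)}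
    {z : N.carrier n} : ((y, z) : N.carrier (n + 1) × N.carrier n) ∈ (interiorCone F).comp n ↔
      z ∈ F.comp n ∧ y + N.d rfl z ∈ F.comp (n + 1) :=
  Iff.rfl

/-- The homotopy sends (y, z) to (z, 0), and (z, 0) lies in W_F as soon as z ∈ F. Nothing about dF
is needed, which makes W_F and its quotient contractible for every F. -/
theorem coneIdHomotopy_mem {F : GrSubmodule N.toGrModule} {i j : ℤ} (h : j + 1 = i)
    {x : (cone (Hom.id N)).carrier i} (hx : x ∈ (interiorCone F).comp i) :
    (coneIdHomotopy N).s h x ∈ (interiorCone F).comp j := by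
  subst h
  refine mem_interiorCone.2 ⟨zero_mem _, ?_⟩
  rw [map_zero, add_zero]
  exact hx.1

theorem isContractible_interiorCone_sub (F : GrSubmodule N.toGrModule) :
    (interiorCone F).sub.IsContractible :=
  .of_injective (coneIdHomotopy N) (interiorCone F).incl (interiorCone F).incl_injective
    fun h x => (interiorCone F).exists_incl_eq.2
      (coneIdHomotopy_mem h ((interiorCone F).exists_incl_eq.1 ⟨x, rfl⟩))

theorem isContractible_interiorCone_quot (F : GrSubmodule N.toGrModule) :
    (interiorCone F).quot.IsContractible :=
  .of_surjective (coneIdHomotopy N) (interiorCone F).proj (interiorCone F).proj_surjective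
    fun h _ hx => (interiorCone F).proj_eq_zero.2
      (coneIdHomotopy_mem h ((interiorCone F).proj_eq_zero.1 hx))

theorem coneInr_mem_interiorCone {F : GrSubmodule N.toGrModule} {n : ℤ} {z : N.carrier n} :
    (coneInr (Hom.id N)).app n z ∈ (interiorCone F).comp n ↔ z ∈ (interior F).comp n := by
  have e : z ∈ F.comp n ∧ (0 : N.carrier (n + 1)) + N.d rfl z ∈ F.comp (n + 1) ↔
      z ∈ (interior F).comp n := by
    rw [zero_add, mem_interior]
  exact mem_interiorCone.trans e

/-- The hypothesis under which the sequence `0 → Z_F → W_F → Z_{F'}[1] → 0` is exact, where `Z`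
stands for `interior` and `W` for `interiorCone`: one has `F + d F ⊆ F'`, and every element of
`Z_{F'}` lies in `F + d F`. -/
structure IsInteriorStep (F F' : GrSubmodule N.toGrModule) : Prop where
  le : ∀ n, F.comp n ≤ F'.comp n
  mapsInto : N.MapsInto F F'
  exists_mem : ∀ (n : ℤ) (y : N.carrier n), y ∈ (interior F').comp n →
    ∃ (m : ℤ) (h : m + 1 = n) (z : N.carrier m), z ∈ F.comp m ∧ y + N.d h z ∈ F.comp n

/-- Identifies the image of W_F under the projection to N[1]; this is the only place where the
fields of `IsInteriorStep` are used. -/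
theorem IsInteriorStep.mem_interior_iff {F F' : GrSubmodule N.toGrModule}
    (h : IsInteriorStep F F') {n : ℤ} {y : N.carrier (n + 1)} :
    y ∈ (interior F').comp (n + 1) ↔ ∃ z : N.carrier n,
      ((y, z) : N.carrier (n + 1) × N.carrier n) ∈ (interiorCone F).comp n := by
  constructor
  · intro hy
    obtain ⟨m, e, z, hz⟩ := h.exists_mem _ y hy
    obtain rfl : m = n := by omega
    exact ⟨z, hz⟩
  · rintro ⟨z, hz, hy⟩
    change z ∈ F.comp n at hz
    change y + N.d rfl z ∈ F.comp (n + 1) at hy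
    -- y = (y + dz) - dz and dy = d(y + dz) - hz, with h the curvature; all terms on the right lie
    -- in F'.
    have e₁ := sub_mem (h.le _ hy) (h.mapsInto rfl z hz)
    have e₂ := sub_mem (h.mapsInto rfl _ hy) (h.le _ (F.smul_mem (by omega) C.curv hz))
    rw [add_sub_cancel_right] at e₁
    rw [map_add, N.d_d, add_sub_cancel_right] at e₂
    exact ⟨e₁, e₂⟩

variable {P : CDGModule.{u, v} C → Prop}

/-- Two out of three in 0 → Z_F → W_F → Z_{F'}[1] → 0, whose middle term is contractible. -/
theorem IsInteriorStep.sub_mem (hP : IsTriangulatedSubcategory P) (hT : ContainsTotalizations P)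
    {F F' : GrSubmodule N.toGrModule} (h : IsInteriorStep F F') (hF : P (interior F).sub) :
    P (interior F').sub := by
  obtain ⟨f, g, hfg⟩ := (coneInr_shortExact (Hom.id N)).exists_sub (interior F).incl
    (interiorCone F).incl ((interior F').incl.shift 1) (interior F).incl_injective
    (interiorCone F).incl_injective (fun n => (interior F').incl_injective (n + 1))
    (fun n x => by
      rw [CDGSubmodule.exists_incl_eq, CDGSubmodule.exists_incl_eq]
      exact coneInr_mem_interiorCone)
    (fun n y => by
      refine ((interior F').exists_incl_eq (n := n + 1) (x := y)).trans (h.mem_interior_iff.trans ?_)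
      exact ⟨fun ⟨z, hz⟩ => by
          obtain ⟨w, hw⟩ := (interiorCone F).exists_incl_eq.2 hz
          exact ⟨w, by rw [hw]; rfl⟩, by
        rintro ⟨w, rfl⟩
        exact ⟨_, (interiorCone F).exists_incl_eq.1 ⟨w, rfl⟩⟩⟩)
  exact hP.of_shift (hP.right_of_shortExact hT hfg hF
    (hP.of_isContractible (isContractible_interiorCone_sub F)))

/-- Two out of three in 0 → N/Z_F → cone(id_N)/W_F → (N/Z_{F'})[1] → 0. Membership now passes from
the larger submodule F' to the smaller F, as a decreasing filtration requires. -/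
theorem IsInteriorStep.quot_mem (hP : IsTriangulatedSubcategory P) (hT : ContainsTotalizations P)
    {F F' : GrSubmodule N.toGrModule} (h : IsInteriorStep F F') (hF : P (interior F').quot) :
    P (interior F).quot := by
  obtain ⟨f, g, hfg⟩ := (coneInr_shortExact (Hom.id N)).exists_quot (interior F).proj
    (interiorCone F).proj ((interior F').proj.shift 1) (interior F).proj_surjective
    (interiorCone F).proj_surjective (fun n => (interior F').proj_surjective (n + 1))
    (fun n x => by
      rw [CDGSubmodule.proj_eq_zero, CDGSubmodule.proj_eq_zero]
      exact coneInr_mem_interiorCone)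
    (fun n y => by
      refine ((interior F').proj_eq_zero (n := n + 1) (x := y)).trans (h.mem_interior_iff.trans ?_)
      exact ⟨fun ⟨z, hz⟩ => ⟨_, (interiorCone F).proj_eq_zero.2 hz, rfl⟩, by
        rintro ⟨⟨y', z⟩, hz, rfl⟩
        exact ⟨z, (interiorCone F).proj_eq_zero.1 hz⟩⟩)
  exact hP.left_of_shortExact hT hfg
    (hP.of_isContractible (isContractible_interiorCone_quot F)) (hP.shift_mem 1 hF)

/-! ### Direct sums and the telescope of an increasing union -/

/-- The difference of two morphisms. -/
def Hom.sub {M N : CDGModule.{u, v} C} (f g : Hom M N) : Hom M N where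
  app n := f.app n - g.app n
  app_smul h b x := by simp [f.app_smul, g.app_smul]
  comm h x := by simp [f.comm, g.comm]

section DirectSum

variable {ι : Type v} [DecidableEq ι] (M : ι → CDGModule.{u, v} C) {N : CDGModule.{u, v} C}

/-- The inclusion of a summand in a direct sum. -/
def directSumOf (a : ι) : Hom (M a) (directSum M) where
  app n := DirectSum.of (fun a => (M a).carrier n) a
  app_smul h b x := (DirectSum.map_of (fun a => (M a).smul h b) a x).symm
  comm h x := (DirectSum.map_of (fun a => (M a).d h) a x).symm

variable {M}

/-- The morphism from a direct sum given by its restrictions to the summands. -/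
def directSumDesc (f : ∀ a, Hom (M a) N) : Hom (directSum M) N where
  app n := DirectSum.toAddMonoid (fun a => (f a).app n)
  app_smul {i j k} h b x := by
    have key : (DirectSum.toAddMonoid fun a => (f a).app k).comp
        (DirectSum.map fun a => (M a).smul h b) =
        (N.smul h b).comp (DirectSum.toAddMonoid fun a => (f a).app j) :=
      DirectSum.addHom_ext fun a x => by simp [DirectSum.map_of, (f a).app_smul]
    exact DFunLike.congr_fun key x
  comm {i j} h x := by
    have key : (DirectSum.toAddMonoid fun a => (f a).app j).comp
        (DirectSum.map fun a => (M a).d h) =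
        (N.d h).comp (DirectSum.toAddMonoid fun a => (f a).app i) :=
      DirectSum.addHom_ext fun a x => by simp [DirectSum.map_of, (f a).comm]
    exact DFunLike.congr_fun key x

theorem directSumDesc_of (f : ∀ a, Hom (M a) N) (a : ι) (n : ℤ) (x : (M a).carrier n) :
    (directSumDesc f).app n ((directSumOf M a).app n x) = (f a).app n x :=
  DirectSum.toAddMonoid_of (fun a => (f a).app n) a x

theorem directSum_induction {n : ℤ} {p : (directSum M).carrier n → Prop} (x)
    (zero : p 0) (of : ∀ a x, p ((directSumOf M a).app n x))
    (add : ∀ x y, p x → p y → p (x + y)) : p x :=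
  DirectSum.induction_on (motive := p) x zero of add

end DirectSum

/-- The mapping telescope sequence of an increasing exhaustive sequence of submodules `X i` of
`N`, where `j i` is the inclusion of `X i` and `t i` is the transition morphism. -/
theorem exists_telescope {X : ℕ → CDGModule.{u, v} C} {N : CDGModule.{u, v} C}
    (t : ∀ i, Hom (X i) (X (i + 1))) (j : ∀ i, Hom (X i) N)
    (hj : ∀ i n, Function.Injective ((j i).app n))
    (ht : ∀ i n x, (j (i + 1)).app n ((t i).app n x) = (j i).app n x)
    (hN : ∀ n (y : N.carrier n), ∃ i x, (j i).app n x = y) :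
    ∃ (f : Hom (directSum fun a : ULift.{v} ℕ => X a.down)
        (directSum fun a : ULift.{v} ℕ => X a.down))
      (g : Hom (directSum fun a : ULift.{v} ℕ => X a.down) N), ShortExact f g := by
  -- Direct sums are indexed by types in universe v, hence the lift of ℕ.
  let S := directSum fun a : ULift.{v} ℕ => X a.down
  let o : ∀ i : ℕ, Hom (X i) S := fun i => directSumOf (fun a : ULift.{v} ℕ => X a.down) ⟨i⟩
  let f : Hom S S := directSumDesc fun a => (o a.down).sub ((o (a.down + 1)).comp (t a.down))
  let g : Hom S N := directSumDesc fun a => j a.down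
  have hf : ∀ i n x, f.app n ((o i).app n x) = (o i).app n x - (o (i + 1)).app n ((t i).app n x) :=
    fun i n x => directSumDesc_of (M := fun a : ULift.{v} ℕ => X a.down) _ (ULift.up i) n x
  have hg : ∀ i n x, g.app n ((o i).app n x) = (j i).app n x :=
    fun i n x => directSumDesc_of (M := fun a : ULift.{v} ℕ => X a.down) _ (ULift.up i) n x
  have ind : ∀ {n : ℤ} {p : S.carrier n → Prop} (x) (_zero : p 0)
      (_of : ∀ a x, p ((o a).app n x)) (_add : ∀ x y, p x → p y → p (x + y)), p x :=
    fun x h₁ h₂ h₃ => directSum_induction x h₁ (fun a x => h₂ a.down x) h₃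
  have hw : ∀ n x, g.app n (f.app n x) = 0 := by
    intro n x
    induction x using ind with
    | _zero => simp only [map_zero]
    | _of i x => rw [hf, map_sub, hg, hg, ht, sub_self]
    | _add x y hx hy => rw [map_add, map_add, hx, hy, add_zero]
  -- Reading the components inside N makes the transition morphisms disappear: f becomes (x_b) ↦
  -- (x_b - x_{b-1}), with x_{-1} = 0.
  let p : ∀ (b : ℕ) (n : ℤ), S.carrier n →+ N.carrier n := fun b n =>
    ((j b).app n).comp (DFinsupp.evalAddMonoidHom (ULift.up b))
  have hp_self : ∀ i n x, p i n ((o i).app n x) = (j i).app n x := fun i n x =>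
    congrArg ((j i).app n) (DirectSum.of_eq_same _ _)
  have hp_ne : ∀ b i n x, i ≠ b → p b n ((o i).app n x) = 0 := fun b i n x h =>
    (congrArg ((j b).app n) (DirectSum.of_eq_of_ne (β := fun a : ULift.{v} ℕ => (X a.down).carrier n)
      (ULift.up i) (ULift.up b) x
      fun e => h (congrArg ULift.down e).symm)).trans (map_zero _)
  have hp_zero : ∀ n x, p 0 n (f.app n x) = p 0 n x := by
    intro n x
    induction x using ind with
    | _zero => simp only [map_zero]
    | _of i x => rw [hf, map_sub, hp_ne 0 (i + 1) n _ (by omega), sub_zero]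
    | _add x y hx hy => simp only [map_add, hx, hy]
  have hp_succ : ∀ b n x, p (b + 1) n (f.app n x) = p (b + 1) n x - p b n x := by
    intro b n x
    induction x using ind with
    | _zero => simp only [map_zero, sub_zero]
    | _of i x =>
      rw [hf, map_sub]
      congr 1
      by_cases h : i = b
      · subst h
        rw [hp_self, hp_self, ht]
      · rw [hp_ne _ _ _ _ h, hp_ne _ _ _ _ (by omega)]
    | _add x y hx hy =>
      simp only [map_add, hx, hy]
      abel
  -- Modulo the image of f an element of one summand can be pushed to any later summand, so every
  -- element of the sum is congruent to one concentrated in a single summand (`hrep`).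
  have hlift : ∀ i k, i ≤ k → ∀ n x, ∃ y w, (o i).app n x = (o k).app n y + f.app n w := by
    intro i k hik
    induction k, hik using Nat.le_induction with
    | base => exact fun n x => ⟨x, 0, by rw [map_zero, add_zero]⟩
    | succ k _ ih =>
      intro n x
      obtain ⟨y, w, h⟩ := ih n x
      refine ⟨(t k).app n y, w + (o k).app n y, ?_⟩
      rw [map_add, hf, h]
      abel
  have hrep : ∀ n x, ∃ i y w, x = (o i).app n y + f.app n w := by
    intro n x
    induction x using ind with
    | _zero => exact ⟨0, 0, 0, by simp only [map_zero, add_zero]⟩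
    | _of i x => exact ⟨i, x, 0, by rw [map_zero, add_zero]⟩
    | _add x x' hx hx' =>
      obtain ⟨i, y, w, rfl⟩ := hx
      obtain ⟨i', y', w', rfl⟩ := hx'
      obtain ⟨z, v, h⟩ := hlift i (max i i') (le_max_left _ _) n y
      obtain ⟨z', v', h'⟩ := hlift i' (max i i') (le_max_right _ _) n y'
      refine ⟨max i i', z + z', w + w' + v + v', ?_⟩
      rw [h, h']
      simp only [map_add]
      abel
  refine ⟨f, g, fun n => (injective_iff_map_eq_zero _).2 fun x hx => ?_,
    fun n x => ⟨fun hx => ?_, by rintro ⟨y, rfl⟩; exact hw n y⟩, fun n y => ?_⟩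
  · have hp : ∀ b, p b n x = 0 := by
      intro b
      induction b with
      | zero => rw [← hp_zero, hx, map_zero]
      | succ b ih =>
        have := hp_succ b n x
        rwa [hx, map_zero, ih, sub_zero, eq_comm] at this
    exact DFinsupp.ext fun a => hj a.down n ((hp a.down).trans (map_zero _).symm)
  -- The representative y in one summand has the same image in N as x, namely 0, so y = 0 by
  -- injectivity of `j i`.
  · obtain ⟨i, y, w, rfl⟩ := hrep n x
    rw [map_add, hw, add_zero, hg] at hx
    rw [hj i n (hx.trans (map_zero _).symm), map_zero, zero_add]
    exact ⟨w, rfl⟩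
  · obtain ⟨i, x, rfl⟩ := hN n y
    exact ⟨(o i).app n x, hg i n x⟩

/-! ### Products and the telescope of a limit -/

/-- The morphism to a product given by its components. -/
def productLift {ι : Type v} {M : ι → CDGModule.{u, v} C} {N : CDGModule.{u, v} C}
    (f : ∀ a, Hom N (M a)) : Hom N (product M) where
  app n := AddMonoidHom.mk' (fun x a => (f a).app n x) fun x y => funext fun _ => map_add _ x y
  app_smul h b x := funext fun a => (f a).app_smul h b x
  comm h x := funext fun a => (f a).comm h x

/-- The projection from a product to a factor. -/
def productProj {ι : Type v} (M : ι → CDGModule.{u, v} C) (a : ι) : Hom (product M) (M a) where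
  app n := Pi.evalAddMonoidHom (fun a => (M a).carrier n) a
  app_smul _ _ _ := rfl
  comm _ _ := rfl

/-- The mapping telescope sequence of a tower of quotients `X i` of `N`, where `q i` is the
projection to `X i` and `t i` is the transition morphism, such that `N` is the limit of the `X i`. -/
theorem exists_cotelescope {X : ℕ → CDGModule.{u, v} C} {N : CDGModule.{u, v} C}
    (t : ∀ i, Hom (X (i + 1)) (X i)) (q : ∀ i, Hom N (X i))
    (hq : ∀ i n, Function.Surjective ((q i).app n))
    (ht : ∀ i n x, (t i).app n ((q (i + 1)).app n x) = (q i).app n x)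
    (hN : ∀ n (x : N.carrier n), (∀ i, (q i).app n x = 0) → x = 0)
    (hN' : ∀ n (s : ∀ i, (X i).carrier n), (∀ i, (t i).app n (s (i + 1)) = s i) →
      ∃ x, ∀ i, (q i).app n x = s i) :
    ∃ (f : Hom N (product fun a : ULift.{v} ℕ => X a.down))
      (g : Hom (product fun a : ULift.{v} ℕ => X a.down)
        (product fun a : ULift.{v} ℕ => X a.down)), ShortExact f g := by
  let π : ∀ i : ℕ, Hom (product fun a : ULift.{v} ℕ => X a.down) (X i) := fun i =>
    productProj (fun a : ULift.{v} ℕ => X a.down) ⟨i⟩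
  refine ⟨productLift fun a => q a.down,
    productLift fun a => (π a.down).sub ((t a.down).comp (π (a.down + 1))),
    fun n => (injective_iff_map_eq_zero _).2 fun x hx => hN n x fun i => congrFun hx (ULift.up i),
    fun n s => ⟨fun hs => ?_, ?_⟩, fun n s => ?_⟩
  -- The kernel of the second map consists of the compatible families.
  · obtain ⟨x, hx⟩ := hN' n (fun i => s (ULift.up i)) fun i =>
      (sub_eq_zero.1 (congrFun hs (ULift.up i))).symm
    exact ⟨x, funext fun a => hx a.down⟩
  · rintro ⟨x, rfl⟩
    exact funext fun a => sub_eq_zero.2 (ht a.down n x).symm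
  -- Since every `q i` is onto, the equations u_i - t(u_{i+1}) = s_i can be solved with all u_i
  -- coming from N: for lifts r_i of the s_i, the partial sums -(r_0 + ⋯ + r_{i-1}) have successive
  -- differences r_i.
  · choose r hr using fun i => hq i n (s (ULift.up i))
    refine ⟨fun a => (q a.down).app n (-∑ i ∈ Finset.range a.down, r i), funext fun a => ?_⟩
    have key : ∀ i, (q i).app n (-∑ i ∈ Finset.range i, r i) -
        (t i).app n ((q (i + 1)).app n (-∑ i ∈ Finset.range (i + 1), r i)) = s (ULift.up i) := by
      intro i
      rw [ht, ← map_sub, Finset.sum_range_succ, neg_add, sub_add_cancel_left, neg_neg, hr]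
    exact key a.down


/-! ### The complex of associated graded pieces in terms of representatives -/

section InducedMap

variable {L K K' : GrSubmodule N.toGrModule} (hL : N.MapsInto L K) (hK : N.MapsInto K K')
  {a a' : ℤ} (ha : a + 1 = a') {n : ℤ}

theorem inducedMap_mk (y : K.comp (n + a)) :
    (N.inducedMap hL hK ha).app n (QuotientAddGroup.mk y) =
      (QuotientAddGroup.mk
        (⟨N.d (by omega) (y : N.carrier (n + a)), hK _ _ y.2⟩ : K'.comp (n + a')) :
        K'.comp (n + a') ⧸ (K.comp (n + a')).addSubgroupOf (K'.comp (n + a'))) :=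
  rfl

theorem exists_mem_of_inducedMap_mk {y : N.carrier (n + a')} (hy : y ∈ K'.comp (n + a'))
    (h : ∃ x, (N.inducedMap hL hK ha).app n x = (QuotientAddGroup.mk (⟨y, hy⟩ : K'.comp (n + a')) :
        K'.comp (n + a') ⧸ (K.comp (n + a')).addSubgroupOf (K'.comp (n + a')))) :
    ∃ (m : ℤ) (h : m + 1 = n + a') (z : N.carrier m), z ∈ K.comp m ∧
      y + N.d h z ∈ K.comp (n + a') := by
  obtain ⟨⟨x⟩, hx⟩ := h
  have e := QuotientAddGroup.eq.1 ((inducedMap_mk hL hK ha x).symm.trans hx)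
  rw [AddSubgroup.mem_addSubgroupOf] at e
  -- The coboundary relation gives y - dx ∈ K; the sign is moved into the witness to match
  -- `IsInteriorStep`.
  refine ⟨n + a, by omega, -x, neg_mem x.2, ?_⟩
  rw [map_neg, add_comm y]
  exact e

theorem inducedMap_mk_eq_zero {y : N.carrier (n + a)} (hy : y ∈ K.comp (n + a))
    (hdy : N.d (show n + a + 1 = n + a' by omega) y ∈ K.comp (n + a')) :
    (N.inducedMap hL hK ha).app n (QuotientAddGroup.mk (⟨y, hy⟩ : K.comp (n + a))) = 0 :=
  (QuotientAddGroup.eq_zero_iff _).2 (AddSubgroup.mem_addSubgroupOf.2 hdy)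

end InducedMap

theorem mem_interior_d {F : GrSubmodule N.toGrModule} {i j : ℤ} (h : i + 1 = j) {x : N.carrier i}
    (hx : x ∈ (interior F).comp i) : N.d h x ∈ F.comp j := by
  subst h
  exact hx.2

theorem interior_mono {F F' : GrSubmodule N.toGrModule} (h : ∀ n, F.comp n ≤ F'.comp n) (n : ℤ) :
    (interior F).comp n ≤ (interior F').comp n :=
  fun _ hx => ⟨h _ hx.1, h _ hx.2⟩

/-- Together with Z_{F'} ⊆ F' this interlaces a filtration with its interiors, so that
exhaustiveness and completeness transfer to the latter. -/
theorem le_interior {F F' : GrSubmodule N.toGrModule} (h : ∀ n, F.comp n ≤ F'.comp n)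
    (hd : N.MapsInto F F') (n : ℤ) : F.comp n ≤ (interior F').comp n :=
  fun x hx => ⟨h _ hx, hd rfl x hx⟩

/-! ### The two filtration theorems -/

/-- A CDG-module with an exhaustive increasing filtration `F` such that `d F_i ⊆ F_{i+1}` and the
complex formed by the shifts of the associated graded pieces is acyclic is coacyclic. -/
theorem isCoacyclic_of_filtration (F : ℕ → GrSubmodule N.toGrModule)
    (hF_zero : ∀ n, (F 0).comp n = ⊥)
    (hF_mono : ∀ i n, (F i).comp n ≤ (F (i + 1)).comp n)
    (hF_exh : IsExhaustive F)
    (hF_d : ∀ i, N.MapsInto (F i) (F (i + 1)))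
    (hF_acyclic : IsAcyclicRight
      (fun i => ((F (i + 1)).subquotient (F i)).shift ((i : ℤ) + 1))
      (fun i => N.inducedMap (hF_d i) (hF_d (i + 1)) (by push_cast; ring))) :
    N.IsCoacyclic := by
  intro P hP hT hS
  have step : ∀ i, IsInteriorStep (F i) (F (i + 1)) := by
    refine fun i => ⟨hF_mono i, hF_d i, fun n y hy => ?_⟩
    -- The piece F_{i+1}/F_i is shifted by i + 1 in the complex, so its component of degree n + i +
    -- 1 appears in degree n. There `h₀` says that y ∈ Z_{F_{i+1}} represents a cocycle.
    obtain ⟨n, rfl⟩ : ∃ m, n = m + ((i : ℤ) + 1) := ⟨n - (i + 1), by omega⟩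
    have h₀ := inducedMap_mk_eq_zero (hF_d i) (hF_d (i + 1))
      (show (i : ℤ) + 1 + 1 = (i + 1 : ℕ) + 1 by push_cast; ring) hy.1 (mem_interior_d _ hy)
    cases i with
    | zero =>
      have e := (injective_iff_map_eq_zero _).1 (hF_acyclic n).1 _ h₀
      -- At the left end of the complex, injectivity already puts y in F_0, so no correction is
      -- needed.
      refine ⟨_, sub_add_cancel _ _, 0, zero_mem _, ?_⟩
      rw [map_zero, add_zero]
      exact AddSubgroup.mem_addSubgroupOf.1 ((QuotientAddGroup.eq_zero_iff _).1 e)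
    | succ i =>
      exact exists_mem_of_inducedMap_mk (hF_d i) (hF_d (i + 1)) _ hy.1
        (((hF_acyclic n).2 i _).1 h₀)
  have hZ : ∀ i, P (interior (F i)).sub := by
    intro i
    induction i with
    | zero =>
      have e : ∀ n (x : (interior (F 0)).sub.carrier n), x = 0 := fun n x =>
        (interior (F 0)).incl_injective n <| by
          have hx := (mem_interior.1 ((interior (F 0)).exists_incl_eq.1 ⟨x, rfl⟩)).1
          rw [hF_zero, AddSubgroup.mem_bot] at hx
          rw [hx, map_zero]
      exact hP.of_isContractible ⟨⟨fun _ => 0, fun _ _ _ _ _ => (e _ _).trans (e _ _).symm,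
        fun _ _ _ => (e _ _).trans (e _ _).symm⟩⟩
    | succ i ih => exact (step i).sub_mem hP hT ih
  choose t ht using fun i => (interior (F (i + 1))).incl.exists_lift
    (interior (F (i + 1))).incl_injective (interior (F i)).incl fun n x =>
      (interior (F (i + 1))).exists_incl_eq.2
        (interior_mono (hF_mono i) n ((interior (F i)).exists_incl_eq.1 ⟨x, rfl⟩))
  obtain ⟨f, g, h⟩ := exists_telescope t (fun i => (interior (F i)).incl)
    (fun i => (interior (F i)).incl_injective) ht fun n y => by
      obtain ⟨i, hi⟩ := hF_exh n y
      -- An element of F_i need not lie in Z_{F_i}, but it lies in Z_{F_{i+1}}.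
      exact ⟨i + 1, (interior (F (i + 1))).exists_incl_eq.2
        (le_interior (hF_mono i) (hF_d i) n hi)⟩
  exact hP.right_of_shortExact hT h (hS _ fun a => hZ a.down) (hS _ fun a => hZ a.down)

/-- A CDG-module with a complete decreasing filtration `F` such that `d F^{i+1} ⊆ F^i` and the
complex formed by the shifts of the associated graded pieces is acyclic is contraacyclic. -/
theorem isContraacyclic_of_filtration (F : ℕ → GrSubmodule N.toGrModule)
    (hF_zero : ∀ n, (F 0).comp n = ⊤)
    (hF_anti : ∀ i n, (F (i + 1)).comp n ≤ (F i).comp n)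
    (hF_complete : IsCompleteFiltration F hF_anti)
    (hF_d : ∀ i, N.MapsInto (F (i + 1)) (F i))
    (hF_acyclic : IsAcyclicLeft
      (fun i => ((F i).subquotient (F (i + 1))).shift (-(i : ℤ)))
      (fun i => N.inducedMap (hF_d (i + 1)) (hF_d i) (by push_cast; ring))) :
    N.IsContraacyclic := by
  intro P hP hT hS
  have step : ∀ i, IsInteriorStep (F (i + 1)) (F i) := by
    refine fun i => ⟨hF_anti i, hF_d i, fun n y hy => ?_⟩
    obtain ⟨n, rfl⟩ : ∃ m, n = m + -(i : ℤ) := ⟨n + i, by omega⟩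
    refine exists_mem_of_inducedMap_mk (hF_d (i + 1)) (hF_d i)
      (show -((i + 1 : ℕ) : ℤ) + 1 = -(i : ℤ) by push_cast; ring) hy.1 ?_
    cases i with
    -- At the right end of the complex every class is a coboundary; the other terms need the cocycle
    -- condition supplied by y ∈ Z_{F^i}.
    | zero => exact (hF_acyclic n).1 _
    | succ i =>
      exact ((hF_acyclic n).2 i _).1 (inducedMap_mk_eq_zero (hF_d (i + 1)) (hF_d i)
        (by push_cast; ring) hy.1 (mem_interior_d _ hy))
  have hZ : ∀ i, P (interior (F i)).quot := by
    intro i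
    induction i with
    | zero =>
      have e : ∀ n (x : (interior (F 0)).quot.carrier n), x = 0 := fun n x => by
        obtain ⟨x, rfl⟩ := (interior (F 0)).proj_surjective n x
        -- F^0 is all of N, hence so is its interior, and the quotient vanishes.
        rw [CDGSubmodule.proj_eq_zero, mem_interior, hF_zero, hF_zero]
        exact ⟨trivial, trivial⟩
      exact hP.of_isContractible ⟨⟨fun _ => 0, fun _ _ _ _ _ => (e _ _).trans (e _ _).symm,
        fun _ _ _ => (e _ _).trans (e _ _).symm⟩⟩
    | succ i ih => exact (step i).quot_mem hP hT ih
  choose t ht using fun i => (interior (F (i + 1))).proj.exists_desc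
    (interior (F (i + 1))).proj_surjective (interior (F i)).proj fun n x hx =>
      (interior (F i)).proj_eq_zero.2
        (interior_mono (hF_anti i) n ((interior (F (i + 1))).proj_eq_zero.1 hx))
  have hsep : ∀ n (x : N.carrier n), (∀ i, x ∈ (F i).comp n) → x = 0 := by
    intro n x hx
    -- Both x and 0 represent the zero family, so uniqueness of the limit identifies them.
    obtain ⟨_, _, h⟩ := hF_complete n (fun _ => 0) fun i => map_zero _
    exact (h x fun i => (QuotientAddGroup.eq_zero_iff x).2 (hx i)).trans (h 0 fun i => rfl).symm
  obtain ⟨f, g, h⟩ := exists_cotelescope t (fun i => (interior (F i)).proj)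
    (fun i => (interior (F i)).proj_surjective) ht
    (fun n x hx => hsep n x fun i => ((interior (F i)).proj_eq_zero.1 (hx i)).1)
    fun n s hs => by
      choose r hr using fun i => (interior (F i)).proj_surjective n (s i)
      -- Since Z_{F^i} ⊆ F^i, representatives of a family compatible modulo the interiors are
      -- compatible modulo the F^i, and completeness yields x with x - r_i ∈ F^i for all i.
      have hr' : ∀ i, r (i + 1) - r i ∈ (interior (F i)).comp n := fun i => by
        rw [← CDGSubmodule.proj_eq_zero, map_sub, hr, ← ht, hr, hs, sub_self]
      obtain ⟨x, hx, -⟩ := hF_complete n (fun i => QuotientAddGroup.mk (r i)) fun i => by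
        refine (QuotientAddGroup.eq.2 ?_).symm
        rw [neg_add_eq_sub]
        exact (hr' i).1
      refine ⟨x, fun i => ?_⟩
      rw [← hr, ← sub_eq_zero, ← map_sub, CDGSubmodule.proj_eq_zero]
      -- The relation x - r_i ∈ F^i is too weak, since Z_{F^i} is needed. One step further, x -
      -- r_{i+1} ∈ F^{i+1} ⊆ Z_{F^i}, and r_{i+1} - r_i ∈ Z_{F^i} as well.
      have e := QuotientAddGroup.eq.1 (hx (i + 1)).symm
      rw [neg_add_eq_sub] at e
      rw [← sub_add_sub_cancel x (r (i + 1)) (r i)]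
      exact add_mem (le_interior (hF_anti i) (hF_d i) n e) (hr' i)
  exact hP.left_of_shortExact hT h (hS _ fun a => hZ a.down) (hS _ fun a => hZ a.down)

end CDGModule

end CDG

theorem mainTheorem1 {B : Type u} [Ring B] {𝓑 : ℤ → AddSubgroup B} [GradedRing 𝓑]
    (C : CDG.CDGRing 𝓑) :
    (∀ (N : CDG.CDGModule.{u, v} C) (F : ℕ → CDG.GrSubmodule N.toGrModule)
      (_hF_zero : ∀ n, (F 0).comp n = ⊥)
      (_hF_mono : ∀ i n, (F i).comp n ≤ (F (i + 1)).comp n)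
      (_hF_exh : CDG.IsExhaustive F)
      (hF_d : ∀ i, N.MapsInto (F i) (F (i + 1)))
      (_hF_acyclic : CDG.IsAcyclicRight
        (fun i => ((F (i + 1)).subquotient (F i)).shift ((i : ℤ) + 1))
        (fun i => N.inducedMap (hF_d i) (hF_d (i + 1)) (by push_cast; ring))),
      N.IsCoacyclic) ∧
    (∀ (Q : CDG.CDGModule.{u, v} C) (F : ℕ → CDG.GrSubmodule Q.toGrModule)
      (_hF_zero : ∀ n, (F 0).comp n = ⊤)
      (hF_anti : ∀ i n, (F (i + 1)).comp n ≤ (F i).comp n)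
      (_hF_complete : CDG.IsCompleteFiltration F hF_anti)
      (hF_d : ∀ i, Q.MapsInto (F (i + 1)) (F i))
      (_hF_acyclic : CDG.IsAcyclicLeft
        (fun i => ((F i).subquotient (F (i + 1))).shift (-(i : ℤ)))
        (fun i => Q.inducedMap (hF_d (i + 1)) (hF_d i) (by push_cast; ring))),
      Q.IsContraacyclic) :=
  ⟨fun _ F hF_zero hF_mono hF_exh hF_d hF_acyclic =>
    CDG.CDGModule.isCoacyclic_of_filtration F hF_zero hF_mono hF_exh hF_d hF_acyclic,
  fun _ F hF_zero hF_anti hF_complete hF_d hF_acyclic =>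
    CDG.CDGModule.isContraacyclic_of_filtration F hF_zero hF_anti hF_complete hF_d hF_acyclic⟩
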